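/- Let $\alpha_1,\alpha_2$ be coprime positive integers, let $d\ge 1$, and let $$F(z_0,z_1,z_2)=f(z_1,z_2)-z_0^d$$ be a complex polynomial with $f\neq 0$ that is weighted homogeneous of degree $d$ for the weights $(1,\alpha_1,\alpha_2)$. It defines the algebraic curve $C=\{F=0\}$ in the weighted projective plane $\mathbb{P}(1,\alpha_1,\alpha_2)$, with affine part $C_{\mathrm{aff}}=\{(z_1,z_2)\in\mathbb{C}^2 : f(z_1,z_2)=1\}$. Let $\Sigma$ be the closure in the unit sphere $S^3\subset\mathbb{C}^2$ of the image of $C_{\mathrm{aff}}\setminus\{(0,0)\}$ under the weighted radial projection, which sends $(z_1,z_2)\ne(0,0)$ to the unique point of $S^3$ of the form $(z_1/r^{\alpha_1},z_2/r^{\alpha_2})$ with $r>0$. Then $\Sigma$ is a positive $d$-section for the flow $(z_1,z_2)\mapsto(e^{i\alpha_1\theta}z_1,e^{i\alpha_2\theta}z_2)$ on $S^3$ if and only if $F$ is non-singular. Here $F$ is called non-singular if $F=\partial F/\partial z_0=\partial F/\partial z_1=\partial F/\partial z_2=0$ has no solution in $\mathbb{C}^3\setminus\{(0,0,0)\}$.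 A $d$-section is a smoothly embedded compact surface $\Sigma\subset S^3$ whose boundary $\partial\Sigma$ is a union of orbits of the flow and whose interior meets every orbit not contained in $\partial\Sigma$ transversely, in exactly $d/m$ points if the orbit has multiplicity $m$, where $m$ is the order of the isotropy group in $\mathbb{R}/2\pi\mathbb{Z}$ of the points on the orbit (so in $d$ points if the orbit is regular, i.e. $m=1$). Here $S^3$ is oriented as the boundary of the unit ball, and $\Sigma$ is oriented so that the flow intersects its interior positively; the $d$-section is positive if along every component of $\partial\Sigma$ the induced boundary orientation is the direction of the flow. -/

import Mathlib

open scoped ContDiff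

namespace SeifertSection

noncomputable section

/-! ### Weighted projective planes and curves in them -/

/-- The equivalence relation on `ℂ³ ∖ {0}` whose classes are the orbits of the `ℂ*`-action
`c · (z₀, z₁, z₂) = (c ^ a₀ z₀, c ^ a₁ z₁, c ^ a₂ z₂)`. -/
def weightedSetoid (a : Fin 3 → ℕ) : Setoid {z : Fin 3 → ℂ // z ≠ 0} where
  r z w := ∃ c : ℂˣ, ∀ i, w.1 i = (c : ℂ) ^ a i * z.1 i
  iseqv :=
    { refl := fun z => ⟨1, fun i => by simp⟩
      symm := by
        rintro z w ⟨c, hc⟩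
        refine ⟨c⁻¹, fun i => ?_⟩
        rw [hc i, ← mul_assoc, ← mul_pow, Units.inv_mul, one_pow, one_mul]
      trans := by
        rintro z w v ⟨c, hc⟩ ⟨e, he⟩
        refine ⟨e * c, fun i => ?_⟩
        rw [he i, hc i, Units.val_mul, mul_pow, mul_assoc] }

/-- The weighted complex projective plane `ℙ(a₀, a₁, a₂)`. -/
def WeightedProjectivePlane (a : Fin 3 → ℕ) : Type := Quotient (weightedSetoid a)

/-- The point `[z₀ : z₁ : z₂]` of `ℙ(a₀, a₁, a₂)`. -/
def WeightedProjectivePlane.mk (a : Fin 3 → ℕ) (z : Fin 3 → ℂ) (hz : z ≠ 0) :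
    WeightedProjectivePlane a :=
  Quotient.mk (weightedSetoid a) ⟨z, hz⟩

/-- The zero set `{F = 0}` in `ℙ(a₀, a₁, a₂)` of a weighted homogeneous polynomial `F`
(for such `F` it does not depend on the representatives). -/
def curve (a : Fin 3 → ℕ) (F : MvPolynomial (Fin 3) ℂ) : Set (WeightedProjectivePlane a) :=
  {P | ∃ (z : Fin 3 → ℂ) (hz : z ≠ 0),
    P = WeightedProjectivePlane.mk a z hz ∧ MvPolynomial.eval z F = 0}

/-- `F` is non-singular: `F` and its three partial derivatives have no common zero in
`ℂ³ ∖ {0}`. -/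
def NonSingular (F : MvPolynomial (Fin 3) ℂ) : Prop :=
  ¬ ∃ z : Fin 3 → ℂ, z ≠ 0 ∧ MvPolynomial.eval z F = 0 ∧
    ∀ i, MvPolynomial.eval z (MvPolynomial.pderiv i F) = 0

/-- `ℂ²` with its Euclidean norm. -/
abbrev C2 : Type := EuclideanSpace ℂ (Fin 2)

/-- The unit sphere `S³ ⊆ ℂ²`. -/
abbrev S3 : Set C2 := Metric.sphere (0 : C2) 1

/-- The weights `(1, α₁, α₂)`; here `α 0` and `α 1` stand for `α₁` and `α₂`. -/
abbrev weights (α : Fin 2 → ℕ) : Fin 3 → ℕ := ![1, α 0, α 1]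

/-- The affine chart `(w₁, w₂) ↦ [1 : w₁ : w₂]` of `ℙ(1, α₁, α₂)`, which identifies `ℂ²` with
`{z₀ ≠ 0}`. -/
def affineChart (α : Fin 2 → ℕ) (w : C2) : WeightedProjectivePlane (weights α) :=
  WeightedProjectivePlane.mk (weights α) ![1, w 0, w 1]
    (fun h => one_ne_zero (α := ℂ) (by simpa using congrFun h 0))

/-- The affine part in `ℂ²` of the curve `{F = 0} ⊆ ℙ(1, α₁, α₂)`. -/
def affinePart (α : Fin 2 → ℕ) (F : MvPolynomial (Fin 3) ℂ) : Set C2 :=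
  affineChart α ⁻¹' curve (weights α) F

/-! ### The weighted radial projection and the flow -/

/-- The image in `S³` of `A ∖ {0}` under the weighted radial projection, which sends `z ≠ 0` to
the unique point of `S³` of the form `(z₁ / r ^ α₁, z₂ / r ^ α₂)` with `r > 0`. -/
def radialImage (α : Fin 2 → ℕ) (A : Set C2) : Set C2 :=
  {p | p ∈ S3 ∧ ∃ z ∈ A, z ≠ 0 ∧ ∃ r : ℝ, 0 < r ∧ ∀ i, p i = z i / (r : ℂ) ^ α i}

/-- The flow `(z₁, z₂) ↦ (e^{iα₁θ} z₁, e^{iα₂θ} z₂)`. -/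
def flow (α : Fin 2 → ℕ) (θ : ℝ) (p : C2) : C2 :=
  WithLp.toLp 2 fun i => Complex.exp (Complex.I * α i * θ) * p i

/-- The vector field `(iα₁ z₁, iα₂ z₂)` that generates the flow. -/
def flowField (α : Fin 2 → ℕ) (p : C2) : C2 :=
  WithLp.toLp 2 fun i => Complex.I * α i * p i

/-- The orbit of `p`. -/
def orbit (α : Fin 2 → ℕ) (p : C2) : Set C2 := Set.range fun θ : ℝ => flow α θ p

/-- The multiplicity of the orbit of `p`: the order of the isotropy group of `p` in
`S¹ = ℝ / 2πℤ`. It is `1` on the regular orbits. -/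
def multiplicity (α : Fin 2 → ℕ) (p : C2) : ℕ :=
  Set.ncard {θ : ℝ | θ ∈ Set.Ico 0 (2 * Real.pi) ∧ flow α θ p = p}

/-! ### Embedded surfaces with boundary

A subset of `S³` is an embedded surface in `S³` if and only if it is one in `ℂ² = ℝ⁴`; so
submanifold charts of `ℂ²` are used. -/

/-- `φ` is a `C^∞` chart of `ℂ² = ℝ⁴`. -/
def IsSmoothChart (φ : OpenPartialHomeomorph C2 (Fin 4 → ℝ)) : Prop :=
  ContDiffOn ℝ ∞ φ φ.source ∧ ContDiffOn ℝ ∞ φ.symm φ.target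

/-- In the chart `φ` the set `S` is the plane `x₂ = x₃ = 0` (coordinates `x₀, x₁, x₂, x₃`). -/
def IsInteriorChart (S : Set C2) (φ : OpenPartialHomeomorph C2 (Fin 4 → ℝ)) : Prop :=
  IsSmoothChart φ ∧ ∀ q ∈ φ.source, q ∈ S ↔ φ q 2 = 0 ∧ φ q 3 = 0

/-- In the chart `φ` the set `S` is the half plane `x₂ = x₃ = 0`, `x₀ ≤ 0`. -/
def IsBoundaryChart (S : Set C2) (φ : OpenPartialHomeomorph C2 (Fin 4 → ℝ)) : Prop :=
  IsSmoothChart φ ∧ ∀ q ∈ φ.source, q ∈ S ↔ φ q 2 = 0 ∧ φ q 3 = 0 ∧ φ q 0 ≤ 0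

/-- The interior points of the surface `S`. -/
def surfaceInterior (S : Set C2) : Set C2 :=
  {p | p ∈ S ∧ ∃ φ, IsInteriorChart S φ ∧ p ∈ φ.source}

/-- The boundary points of the surface `S`. -/
def surfaceBoundary (S : Set C2) : Set C2 :=
  {p | p ∈ S ∧ ∃ φ, IsBoundaryChart S φ ∧ p ∈ φ.source ∧ φ p 0 = 0}

/-- `S` is a smooth embedded compact surface in `S³`, possibly with boundary. -/
def IsCompactSurface (S : Set C2) : Prop :=
  S ⊆ S3 ∧ IsCompact S ∧ ∀ p ∈ S, p ∈ surfaceInterior S ∨ p ∈ surfaceBoundary S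

/-- The tangent vectors of `S` at `p`: the velocities at `p` of the curves in `S` through `p`.
At an interior point of a surface they form its tangent plane. -/
def tangentVectors (S : Set C2) (p : C2) : Set C2 :=
  {v | ∃ γ : ℝ → C2, γ 0 = p ∧ HasDerivAt γ v 0 ∧ ∀ᶠ t in nhds 0, γ t ∈ S}

/-- The determinant of four vectors of `ℂ² = ℝ⁴` with respect to the complex orientation. -/
def det4 (u v w x : C2) : ℝ :=
  Matrix.det (Matrix.of fun i j : Fin 4 =>
    ![(![u, v, w, x] i 0).re, (![u, v, w, x] i 0).im,
      (![u, v, w, x] i 1).re, (![u, v, w, x] i 1).im] j)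

/-- The coordinate vector field `∂ⱼ` of the chart `φ` at the point `q`. -/
def coordField (φ : OpenPartialHomeomorph C2 (Fin 4 → ℝ)) (j : Fin 4) (q : C2) : C2 :=
  fderiv ℝ φ.symm (φ q) (Pi.single j 1)

/-- The coordinates `(x₀, x₁)` of the submanifold chart `φ` are positive on the surface `S`, which
is oriented in such a way that the flow crosses its interior positively: at interior points `q`,
the tangent plane of `S` followed by the flow direction gives the orientation of `S³`, and `S³` is
oriented as the boundary of the unit ball (the outward normal vector at `q` is `q`). -/
def IsPositiveChart (α : Fin 2 → ℕ) (S : Set C2)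
    (φ : OpenPartialHomeomorph C2 (Fin 4 → ℝ)) : Prop :=
  ∀ q ∈ φ.source ∩ surfaceInterior S,
    0 < det4 q (coordField φ 0 q) (coordField φ 1 q) (flowField α q)

/-- The vector `v` is positively tangent to the boundary of `S` at `p`, for the boundary
orientation induced by the above orientation of `S`: in a boundary chart `x₀ ≤ 0` with `(x₀, x₁)`
positive, `∂₀` is an outward vector, and hence `∂₁` is positively tangent to the boundary. -/
def IsPositiveBoundaryVector (α : Fin 2 → ℕ) (S : Set C2) (p v : C2) : Prop :=
  ∃ φ, IsBoundaryChart S φ ∧ p ∈ φ.source ∧ φ p 0 = 0 ∧ IsPositiveChart α S φ ∧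
    ∃ c : ℝ, 0 < c ∧ v = c • coordField φ 1 p

/-- `S` is a `d`-section for the flow on `S³`: an embedded compact surface whose boundary is a
union of orbits and whose interior meets all the other orbits transversely, namely the regular
ones in `d` points and those of multiplicity `m` in `d / m` points. -/
structure IsSection (α : Fin 2 → ℕ) (d : ℕ) (S : Set C2) : Prop where
  surface : IsCompactSurface S
  boundary : ∀ p ∈ surfaceBoundary S, orbit α p ⊆ surfaceBoundary S
  transverse : ∀ p ∈ surfaceInterior S, flowField α p ∉ tangentVectors S p
  finite : ∀ p ∈ S3, p ∉ surfaceBoundary S → (orbit α p ∩ surfaceInterior S).Finite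
  count : ∀ p ∈ S3, p ∉ surfaceBoundary S →
    multiplicity α p * (orbit α p ∩ surfaceInterior S).ncard = d

/-- A `d`-section is positive if the boundary orientation agrees with the orientation by the flow
along every boundary component. -/
def IsPositiveSection (α : Fin 2 → ℕ) (d : ℕ) (S : Set C2) : Prop :=
  IsSection α d S ∧ ∀ p ∈ surfaceBoundary S, IsPositiveBoundaryVector α S p (flowField α p)

end

end SeifertSection

/-!
The section is an explicit semialgebraic set. Let `f` be weighted homogeneous of degree `d`. On a
weighted dilation orbit `f` is multiplied by the positive factors `r ^ d`, so that the radial image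
of `{f = 1}` is the set of points of `S³` with `f > 0` (`radialImage_eq_posLocus`). Since `f` is an
open map, its closure is `Σ = {f ≥ 0} ∩ S³` (`closure_posLocus`). The flow multiplies `f` by
`e ^ (i d θ)`; hence an orbit on which `f ≠ 0` meets `{f > 0}` in an orbit of the group of `d`-th
roots of unity, and transversely (`orbit_inter_posLocus`, `flowField_notMem_tangentVectors`).
Since the singular points of `F = f - z₀ ^ d` have `z₀ = 0` if `d ≥ 2`, and `f` is a nonzero linear
form if `d = 1`, the polynomial `F` is non-singular if and only if `f` has no critical points on
`{f = 0}` outside the origin (`nonSingular_iff`).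

If there are no such critical points, then `(f, |z|²)` is a submersion at the zeros of `f` on `S³`,
because `df` vanishes on the Euler field there and `d|z|²` does not. So `Σ` is a surface with
boundary `{f = 0}` there, and the complex orientation of `ℂ²` gives the sign of the boundary
orientation (`exists_positive_boundaryChart`).

Conversely, let `p` be a zero of `f` on `S³` with `df = 0`. The orbit of `p` lies in `Σ`, so `p` is
not an interior point of a section, by transversality. It is not a boundary point either: on a
complex line through `p` that is transverse to the orbit, `f` is `ζ ^ k` with `k ≥ 2` in some
coordinate `ζ`, and the velocities of the curves in `Σ` along the `k` rays `ζ ^ k > 0` have the sum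
`0`. In a boundary chart they all lie in a half plane, so they lie on its boundary line, which is
spanned by the flow direction; but they are transverse to it
(`notMem_surfaceBoundary_of_polyDeriv_eq_zero`).
-/

namespace SeifertSection

open MvPolynomial Filter Topology

/-! ### Weighted homogeneous polynomials as functions on `ℂ²` -/

/-- The polynomial function on `ℂ²` defined by `f`. -/
noncomputable def polyFun (f : MvPolynomial (Fin 2) ℂ) (z : C2) : ℂ := eval (fun i => z i) f

/-- The complex differential of the polynomial function `polyFun f` at `z`. -/
noncomputable def polyDeriv (f : MvPolynomial (Fin 2) ℂ) (z : C2) : C2 →L[ℂ] ℂ :=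
  ∑ i, polyFun (pderiv i f) z • (EuclideanSpace.proj i : C2 →L[ℂ] ℂ)

/-- The action `c · (z₁, z₂) = (e^{α₁ c} z₁, e^{α₂ c} z₂)` of `ℂ` on `ℂ²`. Imaginary `c` give the
flow, real `c` the weighted dilations. -/
noncomputable def act (α : Fin 2 → ℕ) (c : ℂ) (z : C2) : C2 :=
  WithLp.toLp 2 fun i => Complex.exp (α i * c) * z i

/-- The Euler vector field `(α₁ z₁, α₂ z₂)`, which generates the weighted dilations. -/
noncomputable def eulerField (α : Fin 2 → ℕ) (z : C2) : C2 :=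
  WithLp.toLp 2 fun i => (α i : ℂ) * z i

@[simp] lemma act_apply (α : Fin 2 → ℕ) (c : ℂ) (z : C2) (i : Fin 2) :
    act α c z i = Complex.exp (α i * c) * z i := rfl

@[simp] lemma eulerField_apply (α : Fin 2 → ℕ) (z : C2) (i : Fin 2) :
    eulerField α z i = α i * z i := rfl

lemma flowField_eq (α : Fin 2 → ℕ) (z : C2) : flowField α z = Complex.I • eulerField α z := by
  ext i
  simp [flowField, eulerField, mul_assoc]

lemma flow_eq_act (α : Fin 2 → ℕ) (θ : ℝ) (z : C2) : flow α θ z = act α (Complex.I * θ) z := by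
  ext i
  simp only [flow, act]
  ring_nf

lemma act_act (α : Fin 2 → ℕ) (c e : ℂ) (z : C2) : act α c (act α e z) = act α (c + e) z := by
  ext i
  simp only [act_apply, mul_add, Complex.exp_add, mul_assoc]

lemma act_zero (α : Fin 2 → ℕ) (z : C2) : act α 0 z = z := by
  ext i
  simp

lemma act_add_smul (α : Fin 2 → ℕ) (c t : ℂ) (z v : C2) :
    act α c (z + t • v) = act α c z + t • act α c v := by
  ext i
  simp only [act_apply, PiLp.add_apply, PiLp.smul_apply, smul_eq_mul]
  ring

lemma act_ne_zero {α : Fin 2 → ℕ} {c : ℂ} {z : C2} (hz : z ≠ 0) : act α c z ≠ 0 := by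
  intro h
  apply hz
  have := congrArg (act α (-c)) h
  rw [act_act, neg_add_cancel, act_zero] at this
  rw [this]
  ext i
  simp

lemma eulerField_ne_zero {α : Fin 2 → ℕ} (hα : ∀ i, 0 < α i) {z : C2} (hz : z ≠ 0) :
    eulerField α z ≠ 0 := by
  intro h
  apply hz
  ext i
  have := congrArg (fun v : C2 => v i) h
  simpa [(hα i).ne'] using this

lemma polyFun_mul (f g : MvPolynomial (Fin 2) ℂ) (z : C2) :
    polyFun (f * g) z = polyFun f z * polyFun g z := by simp [polyFun]

lemma polyDeriv_apply (f : MvPolynomial (Fin 2) ℂ) (z v : C2) :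
    polyDeriv f z v = ∑ i, polyFun (pderiv i f) z * v i := by
  simp [polyDeriv]

lemma analyticOnNhd_polyFun (f : MvPolynomial (Fin 2) ℂ) :
    AnalyticOnNhd ℂ (polyFun f) Set.univ :=
  AnalyticOnNhd.eval_continuousLinearMap' (fun i => (EuclideanSpace.proj i : C2 →L[ℂ] ℂ)) f

lemma contDiff_polyFun (f : MvPolynomial (Fin 2) ℂ) : ContDiff ℝ ∞ (polyFun f) := by
  have : ContDiff ℂ ∞ (polyFun f) := (analyticOnNhd_polyFun f).contDiff
  exact this.restrict_scalars ℝ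

lemma continuous_polyFun (f : MvPolynomial (Fin 2) ℂ) : Continuous (polyFun f) :=
  (contDiff_polyFun f).continuous

lemma hasFDerivAt_polyFun (f : MvPolynomial (Fin 2) ℂ) (z : C2) :
    HasFDerivAt (polyFun f) (polyDeriv f z) z := by
  induction f using MvPolynomial.induction_on with
  | C a =>
    have h1 : polyFun (C a) = fun _ => a := by ext; simp [polyFun]
    have h2 : polyDeriv (C a) z = 0 := by ext; simp [polyDeriv_apply, polyFun]
    rw [h1, h2]
    exact hasFDerivAt_const _ _
  | add p q hp hq =>
    have h1 : polyFun (p + q) = polyFun p + polyFun q := by ext; simp [polyFun]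
    have h2 : polyDeriv (p + q) z = polyDeriv p z + polyDeriv q z := by
      ext; simp [polyDeriv_apply, polyFun]; ring
    rw [h1, h2]
    exact hp.add hq
  | mul_X p i hp =>
    have hX : HasFDerivAt (fun z : C2 => z i) (EuclideanSpace.proj i : C2 →L[ℂ] ℂ) z :=
      (EuclideanSpace.proj i : C2 →L[ℂ] ℂ).hasFDerivAt
    have h1 : polyFun (p * X i) = polyFun p * fun z : C2 => z i := by
      ext; simp [polyFun]
    have h2 : polyDeriv (p * X i) z =
        polyFun p z • (EuclideanSpace.proj i : C2 →L[ℂ] ℂ) + z i • polyDeriv p z := by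
      ext v
      fin_cases i <;> simp [polyDeriv_apply, polyFun, Fin.sum_univ_two, pderiv_X] <;> ring
    rw [h1, h2]
    exact hp.mul hX

lemma hasFDerivAt_polyFun_real (f : MvPolynomial (Fin 2) ℂ) (z : C2) :
    HasFDerivAt (polyFun f) ((polyDeriv f z).restrictScalars ℝ) z :=
  (hasFDerivAt_polyFun f z).restrictScalars ℝ

lemma exists_polyFun_ne_zero {f : MvPolynomial (Fin 2) ℂ} (hf : f ≠ 0) :
    ∃ z, polyFun f z ≠ 0 := by
  by_contra! h
  exact hf (MvPolynomial.funext fun x => by simpa [polyFun] using h (WithLp.toLp 2 x))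

section Homogeneous

variable {α : Fin 2 → ℕ} {d : ℕ} {f : MvPolynomial (Fin 2) ℂ}

lemma polyFun_act (hf : IsWeightedHomogeneous α f d) (c : ℂ) (z : C2) :
    polyFun f (act α c z) = Complex.exp (d * c) * polyFun f z := by
  simp only [polyFun, eval_eq', Finset.mul_sum]
  refine Finset.sum_congr rfl fun m hm => ?_
  have hw := hf (mem_support_iff.1 hm)
  simp only [act_apply, mul_pow, Finset.prod_mul_distrib, ← Complex.exp_nat_mul,
    ← Complex.exp_sum]
  have : ∑ x, (m x : ℂ) * (α x * c) = d * c := by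
    rw [← hw, Finsupp.weight_apply, Finsupp.sum_fintype _ _ (by simp)]
    push_cast [smul_eq_mul]
    simp only [Finset.sum_mul, mul_assoc]
  rw [this]
  ring

lemma polyDeriv_eulerField (hf : IsWeightedHomogeneous α f d) (z : C2) :
    polyDeriv f z (eulerField α z) = d * polyFun f z := by
  have := congrArg (eval fun i => z i) hf.sum_weight_X_mul_pderiv
  simp only [polyDeriv_apply, polyFun, eulerField_apply]
  simp only [map_sum, nsmul_eq_mul, map_mul, map_natCast, eval_X] at this
  rw [← this]
  exact Finset.sum_congr rfl fun i _ => by ring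

lemma polyDeriv_act (hf : IsWeightedHomogeneous α f d) (c : ℂ) (z v : C2) :
    polyDeriv f (act α c z) (act α c v) = Complex.exp (d * c) * polyDeriv f z v := by
  have hl : ∀ z v : C2, HasDerivAt (fun t : ℂ => polyFun f (z + t • v)) (polyDeriv f z v) 0 := by
    intro z v
    have h1 : HasDerivAt (fun t : ℂ => z + t • v) v 0 := by
      simpa using ((hasDerivAt_id (0 : ℂ)).smul_const v).const_add z
    have h2 : HasFDerivAt (polyFun f) (polyDeriv f z) (z + (0 : ℂ) • v) := by
      simpa using hasFDerivAt_polyFun f z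
    exact h2.comp_hasDerivAt (0 : ℂ) h1
  have h1 := (hl z v).const_mul (Complex.exp (d * c))
  have h2 := hl (act α c z) (act α c v)
  simp only [← act_add_smul, polyFun_act hf] at h2
  exact h2.unique h1

/-- A nonzero weighted homogeneous polynomial of weight `1` (for positive weights) is a nonzero
linear form, and hence has no critical points. -/
lemma polyDeriv_ne_zero_of_weight_one (hα : ∀ i, 0 < α i) (hf : IsWeightedHomogeneous α f 1)
    (hf0 : f ≠ 0) (z : C2) : polyDeriv f z ≠ 0 := by
  have hlin : f.IsHomogeneous 1 := by
    intro m hm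
    have hw := hf hm
    rw [Finsupp.weight_apply, Finsupp.sum_fintype _ _ (by simp)] at hw ⊢
    simp only [Fin.sum_univ_two, smul_eq_mul, Pi.one_apply, mul_one] at hw ⊢
    have h0 := Nat.mul_le_mul_left (m 0) (hα 0)
    have h1 := Nat.mul_le_mul_left (m 1) (hα 1)
    by_contra hne
    have : m 0 = 0 ∧ m 1 = 0 := by omega
    simp [this.1, this.2] at hw
  intro h
  apply hf0
  have hp : ∀ i, pderiv i f = 0 := by
    intro i
    have hc := (totalDegree_eq_zero_iff_eq_C.1
      ((totalDegree_zero_iff_isHomogeneous _).2 (hlin.pderiv (i := i))))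
    have hv : polyFun (pderiv i f) z = 0 := by
      have := congrArg (fun L : C2 →L[ℂ] ℂ => L (EuclideanSpace.single i 1)) h
      simpa [polyDeriv_apply] using this
    rw [hc] at hv ⊢
    simpa [polyFun] using hv
  have := hlin.sum_X_mul_pderiv
  simpa [hp] using this.symm

lemma isWeightedHomogeneous_of_rename (h : IsWeightedHomogeneous (weights α)
    (rename Fin.succ f - X 0 ^ d) d) : IsWeightedHomogeneous α f d := by
  have h0 : IsWeightedHomogeneous (weights α) (X 0 ^ d : MvPolynomial (Fin 3) ℂ) d := by
    simpa [weights] using (isWeightedHomogeneous_X ℂ (weights α) 0).pow d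
  have h1 : IsWeightedHomogeneous (weights α) (rename Fin.succ f) d := by
    simpa using h.add h0
  intro m hm
  have h2 := h1 (d := m.mapDomain Fin.succ)
    (by rwa [coeff_rename_mapDomain _ (Fin.succ_injective 2)])
  rw [← h2, Finsupp.weight_apply, Finsupp.weight_apply,
    Finsupp.sum_mapDomain_index (by simp) (by simp [add_mul])]
  refine Finsupp.sum_congr fun i _ => ?_
  fin_cases i <;> simp [weights]

lemma eval_rename_succ_sub (z : Fin 3 → ℂ) : eval z (rename Fin.succ f - X 0 ^ d) =
    polyFun f (WithLp.toLp 2 fun i => z i.succ) - z 0 ^ d := by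
  simp [polyFun, eval_rename, Function.comp_def]

/-- Non-singularity of `f - z₀ᵈ` only depends on the critical points of `f` on the fibre over
`0`. -/
lemma nonSingular_iff (hα : ∀ i, 0 < α i) (hd : 0 < d) (hf : IsWeightedHomogeneous α f d)
    (hf0 : f ≠ 0) : NonSingular (rename Fin.succ f - X 0 ^ d) ↔
      ∀ z : C2, z ≠ 0 → polyFun f z = 0 → polyDeriv f z ≠ 0 := by
  have e1 : ∀ z : Fin 3 → ℂ, eval z (pderiv 0 (rename Fin.succ f - X 0 ^ d)) =
      - (d * z 0 ^ (d - 1)) := by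
    intro z
    have : pderiv 0 (rename Fin.succ f) = 0 := by
      apply pderiv_eq_zero_of_notMem_vars
      intro h
      obtain ⟨i, -, hi⟩ := Finset.mem_image.1 (vars_rename Fin.succ f h)
      exact Fin.succ_ne_zero i hi
    simp [this]
  have e2 : ∀ (z : Fin 3 → ℂ) (i : Fin 2),
      eval z (pderiv i.succ (rename Fin.succ f - X 0 ^ d)) =
      polyFun (pderiv i f) (WithLp.toLp 2 fun i => z i.succ) := by
    intro z i
    have hX : pderiv i.succ (X 0 : MvPolynomial (Fin 3) ℂ) = 0 :=
      pderiv_X_of_ne (Fin.succ_ne_zero i).symm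
    simp [polyFun, hX, pderiv_rename (Fin.succ_injective 2), eval_rename,
      Function.comp_def]
  constructor
  · intro h z hz hfz hdz
    have hp : ∀ i, polyFun (pderiv i f) z = 0 := by
      intro i
      have := congrArg (fun L : C2 →L[ℂ] ℂ => L (EuclideanSpace.single i 1)) hdz
      simpa [polyDeriv_apply] using this
    have hd1 : d ≠ 1 := by
      rintro rfl
      exact polyDeriv_ne_zero_of_weight_one hα hf hf0 z hdz
    have hz' : (WithLp.toLp 2 fun i : Fin 2 => (Fin.cons 0 (fun i => z i) : Fin 3 → ℂ) i.succ)
        = z := by ext i; simp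
    refine h ⟨Fin.cons 0 fun i => z i, ?_, ?_, ?_⟩
    · intro h0
      apply hz
      ext i
      simpa using congrFun h0 i.succ
    · rw [eval_rename_succ_sub, hz', hfz]
      simp [hd.ne']
    · intro i
      refine Fin.cases ?_ (fun i => ?_) i
      · rw [e1]
        simp [show d - 1 ≠ 0 by omega]
      · rw [e2, hz', hp]
  · rintro h ⟨z, hz, hF, hdF⟩
    have h0 : z 0 = 0 := by
      have := hdF 0
      rw [e1, neg_eq_zero, mul_eq_zero] at this
      exact eq_zero_of_pow_eq_zero (this.resolve_left (by exact_mod_cast hd.ne'))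
    refine h (WithLp.toLp 2 fun i => z i.succ) ?_ ?_ ?_
    · intro h1
      apply hz
      ext i
      refine Fin.cases h0 (fun i => ?_) i
      simpa using congrArg (fun v : C2 => v i) h1
    · rw [eval_rename_succ_sub, h0] at hF
      simpa [hd.ne'] using hF
    · ext v
      have := fun i : Fin 2 => (e2 z i).symm.trans (hdF i.succ)
      simp [polyDeriv_apply, this]

end Homogeneous

/-! ### The square norm and the projection to the sphere -/

/-- The square of the Euclidean norm of `ℂ²`. -/
noncomputable def sqNorm (z : C2) : ℝ := ∑ i, Complex.normSq (z i)

/-- The real linear form `z ↦ Re ⟨w, z⟩` on `ℂ²`. -/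
noncomputable def reInner (w : C2) : C2 →L[ℝ] ℝ :=
  ∑ i, Complex.reCLM.comp
    (((starRingEnd ℂ (w i)) • (EuclideanSpace.proj i : C2 →L[ℂ] ℂ)).restrictScalars ℝ)

lemma reInner_apply (w z : C2) :
    reInner w z = ∑ i, ((w i).re * (z i).re + (w i).im * (z i).im) := by
  simp [reInner]

lemma sqNorm_eq (z : C2) : sqNorm z = ‖z‖ ^ 2 := by
  rw [EuclideanSpace.norm_sq_eq]
  simp [sqNorm, Complex.normSq_eq_norm_sq]

lemma mem_S3_iff {z : C2} : z ∈ S3 ↔ sqNorm z = 1 := by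
  rw [sqNorm_eq, mem_sphere_zero_iff_norm, pow_eq_one_iff_of_nonneg (norm_nonneg _) two_ne_zero]

lemma ne_zero_of_mem_S3 {z : C2} (hz : z ∈ S3) : z ≠ 0 := by
  rintro rfl
  simp at hz

lemma contDiff_coord (i : Fin 2) :
    ContDiff ℝ ∞ (fun z : C2 => (z i).re) ∧ ContDiff ℝ ∞ (fun z : C2 => (z i).im) :=
  ⟨(Complex.reCLM.comp ((EuclideanSpace.proj i : C2 →L[ℂ] ℂ).restrictScalars ℝ)).contDiff,
    (Complex.imCLM.comp ((EuclideanSpace.proj i : C2 →L[ℂ] ℂ).restrictScalars ℝ)).contDiff⟩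

lemma contDiff_sqNorm : ContDiff ℝ ∞ sqNorm := by
  have : sqNorm = fun z => ∑ i, ((z i).re * (z i).re + (z i).im * (z i).im) := by
    ext z; simp [sqNorm, Complex.normSq_apply]
  rw [this]
  exact ContDiff.sum fun i _ => ((contDiff_coord i).1.mul (contDiff_coord i).1).add
    ((contDiff_coord i).2.mul (contDiff_coord i).2)

lemma hasFDerivAt_sqNorm (p : C2) : HasFDerivAt sqNorm ((2 : ℝ) • reInner p) p := by
  have e : sqNorm = fun z => ∑ i, ((z i).re * (z i).re + (z i).im * (z i).im) := by
    ext z; simp [sqNorm, Complex.normSq_apply]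
  have hr : ∀ i, HasFDerivAt (fun z : C2 => (z i).re) (Complex.reCLM.comp
    ((EuclideanSpace.proj i : C2 →L[ℂ] ℂ).restrictScalars ℝ)) p := fun i =>
    (Complex.reCLM.comp
      ((EuclideanSpace.proj i : C2 →L[ℂ] ℂ).restrictScalars ℝ)).hasFDerivAt
  have hi : ∀ i, HasFDerivAt (fun z : C2 => (z i).im) (Complex.imCLM.comp
    ((EuclideanSpace.proj i : C2 →L[ℂ] ℂ).restrictScalars ℝ)) p := fun i =>
    (Complex.imCLM.comp
      ((EuclideanSpace.proj i : C2 →L[ℂ] ℂ).restrictScalars ℝ)).hasFDerivAt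
  rw [e]
  refine (HasFDerivAt.fun_sum (u := Finset.univ) fun i _ =>
    ((hr i).mul (hr i)).add ((hi i).mul (hi i))).congr_fderiv ?_
  ext v
  simp [reInner_apply]
  ring

lemma reInner_eulerField_pos {α : Fin 2 → ℕ} (hα : ∀ i, 0 < α i) {z : C2} (hz : z ≠ 0) :
    0 < reInner z (eulerField α z) := by
  have e : reInner z (eulerField α z) = ∑ i, (α i : ℝ) * Complex.normSq (z i) := by
    rw [reInner_apply]
    refine Finset.sum_congr rfl fun i _ => ?_
    simp [Complex.normSq_apply]
    ring
  rw [e]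
  have hne : ∃ i, z i ≠ 0 := by
    by_contra! h
    exact hz (by ext i; simpa using h i)
  obtain ⟨i, hi⟩ := hne
  refine Finset.sum_pos'
    (fun j _ => mul_nonneg (Nat.cast_nonneg _) (Complex.normSq_nonneg _)) ⟨i, Finset.mem_univ _, ?_⟩
  exact mul_pos (by exact_mod_cast hα i) (Complex.normSq_pos.2 hi)

lemma reInner_smul_I_eulerField (α : Fin 2 → ℕ) (z : C2) :
    reInner z (Complex.I • eulerField α z) = 0 := by
  rw [reInner_apply]
  refine Finset.sum_eq_zero fun i _ => ?_
  simp
  ring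

lemma sqNorm_act (α : Fin 2 → ℕ) (c : ℂ) (z : C2) :
    sqNorm (act α c z) = ∑ i, Real.exp (2 * (α i * c.re)) * Complex.normSq (z i) := by
  refine Finset.sum_congr rfl fun i _ => ?_
  rw [act_apply, map_mul, Complex.normSq_eq_norm_sq (Complex.exp _), Complex.norm_exp,
    ← Real.exp_nat_mul]
  simp

lemma flow_mem_S3_iff {α : Fin 2 → ℕ} {θ : ℝ} {z : C2} : flow α θ z ∈ S3 ↔ z ∈ S3 := by
  rw [mem_S3_iff, mem_S3_iff, flow_eq_act, sqNorm_act]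
  simp [sqNorm]

/-- Along a differentiable family of exponents and base points, the action is differentiated by
the product rule. -/
lemma hasDerivAt_act {α : Fin 2 → ℕ} {c : ℝ → ℂ} {γ : ℝ → C2} {c' : ℂ} {γ' : C2} {t : ℝ}
    (hc : HasDerivAt c c' t) (hγ : HasDerivAt γ γ' t) :
    HasDerivAt (fun t => act α (c t) (γ t))
      (act α (c t) γ' + c' • eulerField α (act α (c t) (γ t))) t := by
  rw [hasDerivAt_iff_hasFDerivAt, ← hasFDerivWithinAt_univ, hasFDerivWithinAt_piLp]
  intro i
  rw [hasFDerivWithinAt_univ]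
  have hi : HasDerivAt (fun t => γ t i) (γ' i) t :=
    ((EuclideanSpace.proj i : C2 →L[ℂ] ℂ).restrictScalars ℝ).hasFDerivAt.comp_hasDerivAt t hγ
  have h := ((hc.const_mul (α i : ℂ)).cexp.mul hi).hasFDerivAt
  refine h.congr_fderiv ?_
  ext
  simp
  ring

lemma hasDerivAt_flow (α : Fin 2 → ℕ) (p : C2) :
    HasDerivAt (fun t => flow α t p) (flowField α p) 0 := by
  have h := hasDerivAt_act (α := α) ((Complex.ofRealCLM.hasDerivAt (x := 0)).const_mul Complex.I)
    (hasDerivAt_const (0 : ℝ) p)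
  have z : act α (Complex.I * (0 : ℝ)) (0 : C2) = 0 := by ext i; simp
  simp only [flow_eq_act, flowField_eq]
  simpa [act_zero, z] using h

/-- The weighted radial projection to the sphere is differentiable: close to a point `p` of the
sphere it is `z ↦ act (s z) z` for a function `s` that is differentiable at `p`. -/
lemma exists_radial_projection {α : Fin 2 → ℕ} (hα : ∀ i, 0 < α i) {p : C2} (hp : p ∈ S3) :
    ∃ s : C2 → ℝ, ∃ L : C2 →L[ℝ] ℝ, HasFDerivAt s L p ∧ s p = 0 ∧
      ∀ᶠ z in 𝓝 p, act α (s z : ℂ) z ∈ S3 := by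
  let Φ : C2 × ℝ → ℝ := fun x => ∑ i, Real.exp (2 * (α i * x.2)) *
    ((x.1 i).re * (x.1 i).re + (x.1 i).im * (x.1 i).im)
  have hΦ : ∀ z s, Φ (z, s) = sqNorm (act α (s : ℂ) z) := by
    intro z s
    simp [Φ, sqNorm_act, Complex.normSq_apply]
  have hsm : ContDiff ℝ ∞ Φ := by
    refine ContDiff.sum fun i _ => ContDiff.mul ?_ ?_
    · fun_prop
    · have h1 := (contDiff_coord i).1.comp (contDiff_fst (𝕜 := ℝ) (E := C2) (F := ℝ) (n := ∞))
      have h2 := (contDiff_coord i).2.comp (contDiff_fst (𝕜 := ℝ) (E := C2) (F := ℝ) (n := ∞))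
      exact (h1.mul h1).add (h2.mul h2)
  have hstrict : HasStrictFDerivAt Φ (fderiv ℝ Φ (p, 0)) (p, 0) :=
    hsm.contDiffAt.hasStrictFDerivAt (by simp)
  have hpart : (fderiv ℝ Φ (p, 0)) (0, 1) = 2 * reInner p (eulerField α p) := by
    have h1 : HasDerivAt (fun t : ℝ => ((p, t) : C2 × ℝ)) (0, 1) 0 :=
      (hasDerivAt_const _ _).prodMk (hasDerivAt_id _)
    have h2 := hstrict.hasFDerivAt.comp_hasDerivAt (0 : ℝ) h1
    have h3 : HasDerivAt (fun t : ℝ => act α (t : ℂ) p) (eulerField α p) 0 := by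
      have h := hasDerivAt_act (α := α) (Complex.ofRealCLM.hasDerivAt (x := 0))
        (hasDerivAt_const (0 : ℝ) p)
      have z : act α ((0 : ℝ) : ℂ) (0 : C2) = 0 := by ext i; simp
      simpa [act_zero, z] using h
    have h4 : HasFDerivAt sqNorm ((2 : ℝ) • reInner p) (act α ((0 : ℝ) : ℂ) p) := by
      simpa [act_zero] using hasFDerivAt_sqNorm p
    have h5 := h4.comp_hasDerivAt (0 : ℝ) h3
    have h6 : Φ ∘ (fun t : ℝ => ((p, t) : C2 × ℝ)) = sqNorm ∘ fun t : ℝ => act α (t : ℂ) p := by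
      ext t; simp [hΦ]
    rw [h6] at h2
    simpa using h2.unique h5
  have hne : (fderiv ℝ Φ (p, 0)) (0, 1) ≠ 0 := by
    rw [hpart]
    exact (mul_pos two_pos (reInner_eulerField_pos hα (ne_zero_of_mem_S3 hp))).ne'
  have hinv : (fderiv ℝ Φ (p, 0) ∘L .inr ℝ C2 ℝ).IsInvertible := by
    refine ⟨ContinuousLinearEquiv.unitsEquivAut ℝ (Units.mk0 _ hne), ?_⟩
    ext
    simp
  have h0 : Φ (p, 0) = 1 := by
    rw [hΦ]
    simpa [act_zero] using mem_S3_iff.1 hp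
  refine ⟨hstrict.implicitFunctionOfProdDomain hinv, _,
    (hstrict.hasStrictFDerivAt_implicitFunctionOfProdDomain hinv).hasFDerivAt, ?_, ?_⟩
  · exact (hstrict.eventually_apply_eq_iff_implicitFunctionOfProdDomain hinv).self_of_nhds.1 rfl
  · filter_upwards [hstrict.eventually_apply_implicitFunctionOfProdDomain hinv] with z hz
    rw [mem_S3_iff, ← hΦ, hz, h0]

/-- Every weighted dilation orbit in `ℂ² ∖ {0}` meets the sphere. -/
lemma exists_act_mem_S3 {α : Fin 2 → ℕ} (hα : ∀ i, 0 < α i) {z : C2} (hz : z ≠ 0) :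
    ∃ s : ℝ, act α (s : ℂ) z ∈ S3 := by
  have hα' : ∀ i, (1 : ℝ) ≤ α i := fun i => by exact_mod_cast hα i
  have hN : 0 < sqNorm z := by
    rw [sqNorm_eq]
    positivity
  set s₀ : ℝ := -Real.log (sqNorm z) / 2 with hs₀
  have e₀ : Real.exp (2 * s₀) * sqNorm z = 1 := by
    rw [hs₀, mul_div_cancel₀ _ two_ne_zero, Real.exp_neg, Real.exp_log hN,
      inv_mul_cancel₀ hN.ne']
  have hg : ∀ s : ℝ, sqNorm (act α (s : ℂ) z) =
      ∑ i, Real.exp (2 * (α i * s)) * Complex.normSq (z i) := fun s => by simp [sqNorm_act]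
  have hz0 : sqNorm (act α ((0 : ℝ) : ℂ) z) = sqNorm z := by simp [act_zero]
  have hcont : Continuous fun s : ℝ => sqNorm (act α (s : ℂ) z) := by
    simp only [hg]
    fun_prop
  have key : (1 : ℝ) ∈ Set.range fun s : ℝ => sqNorm (act α (s : ℂ) z) := by
    rcases le_total 0 s₀ with h | h
    · have hle : 1 ≤ sqNorm (act α (s₀ : ℂ) z) := by
        rw [← e₀, hg, sqNorm, Finset.mul_sum]
        refine Finset.sum_le_sum fun i _ => mul_le_mul_of_nonneg_right
          (Real.exp_le_exp.2 ?_) (Complex.normSq_nonneg _)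
        nlinarith [hα' i]
      refine mem_range_of_exists_le_of_exists_ge hcont ⟨0, ?_⟩ ⟨s₀, hle⟩
      rw [hz0, ← e₀]
      exact le_mul_of_one_le_left hN.le (Real.one_le_exp (by linarith))
    · have hle : sqNorm (act α (s₀ : ℂ) z) ≤ 1 := by
        rw [← e₀, hg, sqNorm, Finset.mul_sum]
        refine Finset.sum_le_sum fun i _ => mul_le_mul_of_nonneg_right
          (Real.exp_le_exp.2 ?_) (Complex.normSq_nonneg _)
        nlinarith [hα' i]
      refine mem_range_of_exists_le_of_exists_ge hcont ⟨s₀, hle⟩ ⟨0, ?_⟩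
      rw [hz0, ← e₀]
      exact mul_le_of_le_one_left hN.le (Real.exp_le_one_iff.2 (by linarith))
  obtain ⟨s, hs⟩ := key
  exact ⟨s, mem_S3_iff.2 hs⟩

/-! ### The closure of the projected curve -/

/-- The points of the sphere at which `f` is real and nonnegative. -/
def nonnegLocus (f : MvPolynomial (Fin 2) ℂ) : Set C2 :=
  {p | p ∈ S3 ∧ (polyFun f p).im = 0 ∧ 0 ≤ (polyFun f p).re}

/-- The points of the sphere at which `f` is real and positive. -/
def posLocus (f : MvPolynomial (Fin 2) ℂ) : Set C2 :=
  {p | p ∈ S3 ∧ (polyFun f p).im = 0 ∧ 0 < (polyFun f p).re}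

/-- The points of the sphere at which `f` vanishes. -/
def zeroLocus (f : MvPolynomial (Fin 2) ℂ) : Set C2 := {p | p ∈ S3 ∧ polyFun f p = 0}

lemma isClosed_nonnegLocus (f : MvPolynomial (Fin 2) ℂ) : IsClosed (nonnegLocus f) :=
  Metric.isClosed_sphere.inter
    ((isClosed_eq (Complex.continuous_im.comp (continuous_polyFun f)) continuous_const).inter
      (isClosed_le continuous_const (Complex.continuous_re.comp (continuous_polyFun f))))

lemma isCompact_nonnegLocus (f : MvPolynomial (Fin 2) ℂ) : IsCompact (nonnegLocus f) :=
  (isCompact_sphere (0 : C2) 1).of_isClosed_subset (isClosed_nonnegLocus f) fun _ h => h.1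

lemma posLocus_subset_nonnegLocus (f : MvPolynomial (Fin 2) ℂ) :
    posLocus f ⊆ nonnegLocus f := fun _ h => ⟨h.1, h.2.1, h.2.2.le⟩

lemma zeroLocus_subset_nonnegLocus (f : MvPolynomial (Fin 2) ℂ) :
    zeroLocus f ⊆ nonnegLocus f := fun _ h => ⟨h.1, by simp [h.2], by simp [h.2]⟩

lemma mem_zeroLocus_or_mem_posLocus {f : MvPolynomial (Fin 2) ℂ} {p : C2}
    (hp : p ∈ nonnegLocus f) : p ∈ zeroLocus f ∨ p ∈ posLocus f := by
  rcases hp.2.2.eq_or_lt with h | h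
  · exact Or.inl ⟨hp.1, Complex.ext h.symm hp.2.1⟩
  · exact Or.inr ⟨hp.1, hp.2.1, h⟩

variable {α : Fin 2 → ℕ} {d : ℕ} {f : MvPolynomial (Fin 2) ℂ} {p : C2}

lemma polyFun_act_ofReal (hf : IsWeightedHomogeneous α f d) (s : ℝ) (z : C2) :
    polyFun f (act α (s : ℂ) z) = (Real.exp (d * s) : ℝ) * polyFun f z := by
  rw [polyFun_act hf]
  push_cast
  rfl

lemma exp_mul_eq_pow {c w : ℂ} (h : Complex.exp c = w) (n : ℕ) : Complex.exp (n * c) = w ^ n := by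
  rw [Complex.exp_nat_mul, h]

lemma mem_affinePart_iff (hf : IsWeightedHomogeneous α f d) {w : C2} :
    w ∈ affinePart α (rename Fin.succ f - X 0 ^ d) ↔ polyFun f w = 1 := by
  constructor
  · rintro ⟨z, hz, hmk, hev⟩
    obtain ⟨c, hc⟩ := Quotient.exact hmk
    have h0 : z 0 = c := by simpa [weights] using hc 0
    have h1 : (WithLp.toLp 2 fun i : Fin 2 => z i.succ : C2) = act α (Complex.log c) w := by
      ext i
      have := hc i.succ
      rw [act_apply, exp_mul_eq_pow (Complex.exp_log c.ne_zero)]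
      fin_cases i <;> simpa [weights] using this
    rw [eval_rename_succ_sub, h1, polyFun_act hf, exp_mul_eq_pow (Complex.exp_log c.ne_zero), h0,
      sub_eq_zero] at hev
    exact mul_left_cancel₀ (pow_ne_zero d c.ne_zero) (by rw [hev, mul_one])
  · intro h
    refine ⟨![1, w 0, w 1], _, rfl, ?_⟩
    rw [eval_rename_succ_sub]
    have : (WithLp.toLp 2 fun i : Fin 2 => (![1, w 0, w 1] : Fin 3 → ℂ) i.succ : C2) = w := by
      ext i
      fin_cases i <;> rfl
    rw [this, h]
    simp

lemma radialImage_eq_posLocus (hd : 0 < d) (hf : IsWeightedHomogeneous α f d) :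
    radialImage α (affinePart α (rename Fin.succ f - X 0 ^ d)) = posLocus f := by
  have hexp : ∀ (r : ℝ), 0 < r → Complex.exp (Real.log r : ℝ) = r := by
    intro r hr
    rw [← Complex.ofReal_exp, Real.exp_log hr]
  ext p
  constructor
  · rintro ⟨hp, z, hz, -, r, hr, h⟩
    rw [mem_affinePart_iff hf] at hz
    have hzp : z = act α (Real.log r : ℝ) p := by
      ext i
      have : (r : ℂ) ^ α i ≠ 0 := pow_ne_zero _ (by exact_mod_cast hr.ne')
      rw [act_apply, exp_mul_eq_pow (hexp r hr), h i, mul_div_cancel₀ _ this]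
    rw [hzp, polyFun_act_ofReal hf] at hz
    set e := Real.exp (d * Real.log r) with he
    have hepos : 0 < e := Real.exp_pos _
    have hre := congrArg Complex.re hz
    have him := congrArg Complex.im hz
    rw [Complex.re_ofReal_mul, Complex.one_re] at hre
    rw [Complex.im_ofReal_mul, Complex.one_im] at him
    refine ⟨hp, (mul_eq_zero.1 him).resolve_left hepos.ne', ?_⟩
    by_contra hneg
    nlinarith
  · rintro ⟨hp, him, hre⟩
    set s : ℝ := -Real.log (polyFun f p).re / d with hs
    have hf1 : polyFun f (act α (s : ℂ) p) = 1 := by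
      have hd' : (d : ℝ) ≠ 0 := by exact_mod_cast hd.ne'
      have hx : polyFun f p = ((polyFun f p).re : ℂ) := Complex.ext rfl him
      rw [polyFun_act_ofReal hf, hs, mul_div_cancel₀ _ hd', Real.exp_neg, Real.exp_log hre, hx,
        Complex.ofReal_re, ← Complex.ofReal_mul, inv_mul_cancel₀ hre.ne', Complex.ofReal_one]
    refine ⟨hp, act α (s : ℂ) p, (mem_affinePart_iff hf).2 hf1,
      act_ne_zero (ne_zero_of_mem_S3 hp), Real.exp s, Real.exp_pos s, fun i => ?_⟩
    rw [act_apply, exp_mul_eq_pow (Complex.ofReal_exp s).symm, mul_div_cancel_left₀]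
    exact pow_ne_zero _ (Complex.ofReal_ne_zero.2 (Real.exp_pos s).ne')

/-- By the open mapping theorem, `f` takes positive values close to each of its zeros. -/
lemma zeroLocus_subset_closure_posLocus (hα : ∀ i, 0 < α i) (hf : IsWeightedHomogeneous α f d)
    (hf0 : f ≠ 0) : zeroLocus f ⊆ closure (posLocus f) := by
  rintro p ⟨hp, hfp⟩
  have hopen : 𝓝 (polyFun f p) ≤ map (polyFun f) (𝓝 p) := by
    refine ((analyticOnNhd_polyFun f) p
      (Set.mem_univ _)).eventually_constant_or_nhds_le_map_nhds.resolve_left fun h => ?_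
    obtain ⟨z, hz⟩ := exists_polyFun_ne_zero hf0
    have := (analyticOnNhd_polyFun f).eqOn_zero_of_preconnected_of_eventuallyEq_zero
      isPreconnected_univ (Set.mem_univ p) (h.mono fun z hz => by simpa [hfp] using hz)
    exact hz (this (Set.mem_univ z))
  obtain ⟨s, L, hs, hs0, hev⟩ := exists_radial_projection hα hp
  have hcont : Tendsto (fun z => act α (s z : ℂ) z) (𝓝 p) (𝓝 p) := by
    have h1 : ContinuousAt (fun z => act α (s z : ℂ) z) p := by
      unfold act
      have hc : ContinuousAt (fun z => (s z : ℂ)) p :=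
        Complex.continuous_ofReal.continuousAt.comp hs.continuousAt
      refine (PiLp.continuous_toLp 2 _).continuousAt.comp (continuousAt_pi.2 fun i => ?_)
      exact (Complex.continuous_exp.continuousAt.comp (continuousAt_const.mul hc)).mul
        (EuclideanSpace.proj i : C2 →L[ℂ] ℂ).continuous.continuousAt
    have h2 := h1.tendsto
    rwa [hs0, Complex.ofReal_zero, act_zero] at h2
  rw [mem_closure_iff_nhds]
  intro U hU
  have hmem := hopen (image_mem_map (hev.and (hcont hU)))
  rw [hfp] at hmem
  obtain ⟨ε, hε, hball⟩ := Metric.mem_nhds_iff.1 hmem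
  obtain ⟨z, ⟨hz1, hz2⟩, hz3⟩ := hball (show ((ε / 2 : ℝ) : ℂ) ∈ Metric.ball 0 ε by
    rw [mem_ball_zero_iff, Complex.norm_real, Real.norm_of_nonneg (by positivity)]
    linarith)
  refine ⟨_, hz2, hz1, ?_⟩
  rw [polyFun_act_ofReal hf, hz3, ← Complex.ofReal_mul]
  exact ⟨Complex.ofReal_im _, by rw [Complex.ofReal_re]; positivity⟩

lemma closure_posLocus (hα : ∀ i, 0 < α i) (hf : IsWeightedHomogeneous α f d) (hf0 : f ≠ 0) :
    closure (posLocus f) = nonnegLocus f := by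
  refine subset_antisymm
    (closure_minimal (posLocus_subset_nonnegLocus f) (isClosed_nonnegLocus f)) fun p hp => ?_
  rcases mem_zeroLocus_or_mem_posLocus hp with h | h
  · exact zeroLocus_subset_closure_posLocus hα hf hf0 h
  · exact subset_closure h

/-! ### Intersections of orbits with the positive locus -/

lemma polyFun_flow (hf : IsWeightedHomogeneous α f d) (θ : ℝ) (z : C2) :
    polyFun f (flow α θ z) = Complex.exp (d * (Complex.I * θ)) * polyFun f z := by
  rw [flow_eq_act, polyFun_act hf]

lemma flow_flow (α : Fin 2 → ℕ) (θ η : ℝ) (z : C2) :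
    flow α θ (flow α η z) = flow α (θ + η) z := by
  simp only [flow_eq_act, act_act]
  congr 1
  push_cast
  ring

lemma flow_zero (α : Fin 2 → ℕ) (z : C2) : flow α 0 z = z := by
  simp [flow_eq_act, act_zero]

lemma flow_injective (α : Fin 2 → ℕ) (θ : ℝ) : Function.Injective (flow α θ) := by
  intro z w h
  have := congrArg (flow α (-θ)) h
  simpa [flow_flow, flow_zero] using this

lemma multiplicity_flow (α : Fin 2 → ℕ) (θ : ℝ) (z : C2) :
    multiplicity α (flow α θ z) = multiplicity α z := by
  unfold multiplicity
  congr 1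
  ext η
  simp only [Set.mem_ofPred_eq, flow_flow]
  rw [add_comm, ← flow_flow, (flow_injective α θ).eq_iff]

lemma orbit_flow (α : Fin 2 → ℕ) (θ : ℝ) (z : C2) : orbit α (flow α θ z) = orbit α z := by
  ext w
  constructor
  · rintro ⟨η, rfl⟩
    exact ⟨η + θ, (flow_flow α η θ z).symm⟩
  · rintro ⟨η, rfl⟩
    exact ⟨η - θ, by simp [flow_flow]⟩

/-- The orbit-stabilizer theorem for an action that is not given as an instance. -/
lemma ncard_orbit_mul_ncard_stabilizer {G X : Type*} [Group G] [Finite G] (a : G → X → X)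
    (hone : ∀ x, a 1 x = x) (hmul : ∀ g h x, a (g * h) x = a g (a h x)) (x : X) :
    (Set.range fun g => a g x).ncard * Set.ncard {g | a g x = x} = Nat.card G := by
  let _ : MulAction G X := { smul := a, one_smul := hone, mul_smul := hmul }
  rw [← Nat.card_congr (MulAction.orbitProdStabilizerEquivGroup G x), Nat.card_prod]
  rfl

lemma exists_rootOfUnity (hd : 0 < d) {θ : ℝ} (h : Complex.exp (d * (Complex.I * θ)) = 1) :
    ∃ ζ : rootsOfUnity d ℂ, ((ζ : ℂˣ) : ℂ) = Complex.exp (Complex.I * θ) := by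
  rw [Complex.exp_nat_mul] at h
  have : NeZero d := ⟨hd.ne'⟩
  exact ⟨rootsOfUnity.mkOfPowEq _ h, by simp⟩

lemma exists_flow_angle (hd : 0 < d) (ζ : rootsOfUnity d ℂ) :
    ∃ θ ∈ Set.Ico (0 : ℝ) (2 * Real.pi), Complex.exp (Complex.I * θ) = ((ζ : ℂˣ) : ℂ) := by
  have h1 : ‖((ζ : ℂˣ) : ℂ)‖ = 1 :=
    Complex.norm_eq_one_of_pow_eq_one (by simpa using congrArg Units.val ζ.2) hd.ne'
  refine ⟨toIcoMod Real.two_pi_pos 0 (Complex.arg ((ζ : ℂˣ) : ℂ)), ?_, ?_⟩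
  · simpa using toIcoMod_mem_Ico Real.two_pi_pos 0 (Complex.arg ((ζ : ℂˣ) : ℂ))
  · have h2 := Complex.norm_mul_exp_arg_mul_I ((ζ : ℂˣ) : ℂ)
    rw [h1, Complex.ofReal_one, one_mul] at h2
    rw [← self_sub_toIcoDiv_zsmul, zsmul_eq_mul]
    conv_rhs => rw [← h2]
    rw [Complex.exp_eq_exp_iff_exists_int]
    refine ⟨-toIcoDiv Real.two_pi_pos 0 (Complex.arg ((ζ : ℂˣ) : ℂ)), ?_⟩
    push_cast
    ring

lemma injOn_exp_I_mul : Set.InjOn (fun θ : ℝ => Complex.exp (Complex.I * θ))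
    (Set.Ico 0 (2 * Real.pi)) := by
  intro x hx y hy h
  obtain ⟨n, hn⟩ := Complex.exp_eq_exp_iff_exists_int.1 h
  have h1 : x = y + n * (2 * Real.pi) := by
    have := congrArg Complex.im hn
    simpa using this
  have hπ := Real.two_pi_pos
  have h2 : (n : ℝ) < 1 := by
    by_contra! hc
    have := hx.2; have := hy.1
    nlinarith
  have h3 : (-1 : ℝ) < n := by
    by_contra! hc
    have := hx.1; have := hy.2
    nlinarith
  have : n = 0 := by
    have h2' : n < 1 := by exact_mod_cast h2
    have h3' : -1 < n := by exact_mod_cast h3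
    omega
  simpa [this] using h1

/-- The points of an orbit at which `f` is positive form one orbit of the group of `d`-th roots of
unity, and the stabilizers in this group are the isotropy groups of the flow. So the number of
these points is given by the orbit-stabilizer theorem. -/
lemma orbit_inter_posLocus (hd : 0 < d) (hf : IsWeightedHomogeneous α f d) {p : C2} (hp : p ∈ S3)
    (hfp : polyFun f p ≠ 0) : (orbit α p ∩ posLocus f).Finite ∧
      multiplicity α p * (orbit α p ∩ posLocus f).ncard = d := by
  have hd' : (d : ℂ) ≠ 0 := by exact_mod_cast hd.ne'
  obtain ⟨θ₀, hθ₀⟩ : ∃ θ : ℝ, polyFun f (flow α θ p) = ‖polyFun f p‖ := by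
    refine ⟨-Complex.arg (polyFun f p) / d, ?_⟩
    rw [polyFun_flow hf]
    have : (d : ℂ) * (Complex.I * ((-Complex.arg (polyFun f p) / d : ℝ) : ℂ)) +
        Complex.arg (polyFun f p) * Complex.I = 0 := by
      push_cast
      field_simp
      ring
    calc _ = Complex.exp _ * (‖polyFun f p‖ * Complex.exp (Complex.arg (polyFun f p) *
          Complex.I)) := by rw [Complex.norm_mul_exp_arg_mul_I]
      _ = _ := by rw [mul_left_comm, ← Complex.exp_add, this, Complex.exp_zero, mul_one]
  rw [← orbit_flow α θ₀, ← multiplicity_flow α θ₀]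
  have hq : flow α θ₀ p ∈ S3 := flow_mem_S3_iff.2 hp
  have hx : 0 < ‖polyFun f p‖ := norm_pos_iff.2 hfp
  generalize ‖polyFun f p‖ = x at hθ₀ hx
  generalize flow α θ₀ p = q at hθ₀ hq
  have hx' : (x : ℂ) ≠ 0 := by exact_mod_cast hx.ne'
  have : NeZero d := ⟨hd.ne'⟩
  let a : rootsOfUnity d ℂ → C2 → C2 := fun ζ z =>
    WithLp.toLp 2 fun i => ((ζ : ℂˣ) : ℂ) ^ α i * z i
  have hsmul : ∀ (ζ : rootsOfUnity d ℂ) (θ : ℝ), ((ζ : ℂˣ) : ℂ) = Complex.exp (Complex.I * θ) →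
      a ζ q = flow α θ q := by
    intro ζ θ h
    ext i
    rw [flow_eq_act, act_apply, exp_mul_eq_pow h.symm]
  have horb : orbit α q ∩ posLocus f = Set.range fun ζ => a ζ q := by
    ext w
    constructor
    · rintro ⟨⟨θ, rfl⟩, -, him, hre⟩
      simp only [polyFun_flow hf, hθ₀] at him hre
      rw [Complex.im_mul_ofReal] at him
      rw [Complex.re_mul_ofReal] at hre
      have him' := (mul_eq_zero.1 him).resolve_right hx.ne'
      have hre' := pos_of_mul_pos_left hre hx.le
      have hone : Complex.exp (d * (Complex.I * θ)) = 1 := by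
        have hn : ‖Complex.exp (d * (Complex.I * θ))‖ = 1 := by
          rw [Complex.norm_exp]
          simp
        set e := Complex.exp (d * (Complex.I * θ))
        have he : e = (e.re : ℂ) := Complex.ext rfl him'
        rw [he, Complex.norm_real, Real.norm_of_nonneg hre'.le] at hn
        rw [he, hn, Complex.ofReal_one]
      obtain ⟨ζ, hζ⟩ := exists_rootOfUnity hd hone
      exact ⟨ζ, hsmul ζ θ hζ⟩
    · rintro ⟨ζ, rfl⟩
      obtain ⟨θ, -, hθ⟩ := exists_flow_angle hd ζ
      have hpow : Complex.exp (d * (Complex.I * θ)) = 1 := by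
        rw [exp_mul_eq_pow hθ]
        simpa using congrArg Units.val ζ.2
      simp only [hsmul ζ θ hθ.symm]
      refine ⟨⟨θ, rfl⟩, flow_mem_S3_iff.2 hq, ?_⟩
      rw [polyFun_flow hf, hpow, hθ₀, one_mul]
      exact ⟨Complex.ofReal_im _, by simpa using hx⟩
  have hmult : multiplicity α q = Set.ncard {ζ | a ζ q = q} := by
    have e1 : (fun θ : ℝ => Complex.exp (Complex.I * θ)) ''
        {θ : ℝ | θ ∈ Set.Ico 0 (2 * Real.pi) ∧ flow α θ q = q} =
        (fun ζ : rootsOfUnity d ℂ => ((ζ : ℂˣ) : ℂ)) '' {ζ | a ζ q = q} := by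
      ext w
      constructor
      · rintro ⟨θ, ⟨-, h⟩, rfl⟩
        have hone : Complex.exp (d * (Complex.I * θ)) = 1 := by
          have := congrArg (polyFun f) h
          rw [polyFun_flow hf, hθ₀] at this
          exact mul_right_cancel₀ hx' (by rw [this, one_mul])
        obtain ⟨ζ, hζ⟩ := exists_rootOfUnity hd hone
        exact ⟨ζ, (hsmul ζ θ hζ).trans h, hζ⟩
      · rintro ⟨ζ, h, rfl⟩
        obtain ⟨θ, hθ, hθζ⟩ := exists_flow_angle hd ζ
        exact ⟨θ, ⟨hθ, (hsmul ζ θ hθζ.symm).symm.trans h⟩, hθζ⟩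
    have hinj : Function.Injective fun ζ : rootsOfUnity d ℂ => ((ζ : ℂˣ) : ℂ) :=
      Units.val_injective.comp Subtype.val_injective
    rw [multiplicity, ← (injOn_exp_I_mul.mono fun θ h => h.1).ncard_image, e1,
      Set.ncard_image_of_injective _ hinj]
  rw [horb]
  refine ⟨Set.finite_range _, ?_⟩
  rw [hmult, mul_comm, ncard_orbit_mul_ncard_stabilizer a,
    Complex.card_rootsOfUnity]
  · intro z
    ext i
    simp [a]
  · intro ζ η z
    ext i
    simp [a, mul_pow, mul_assoc]

/-! ### Charts and tangent vectors -/

/-- A smooth map to `ℝ⁴` with injective derivative at `p` is a smooth chart on some neighbourhood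
of `p`, which can be chosen arbitrarily small. -/
lemma exists_isSmoothChart {Φ : C2 → Fin 4 → ℝ} (hΦ : ContDiff ℝ ∞ Φ) {p : C2}
    {Φ' : C2 →L[ℝ] (Fin 4 → ℝ)} (hΦ' : HasFDerivAt Φ Φ' p) (hinj : ∀ v, Φ' v = 0 → v = 0)
    {U : Set C2} (hU : U ∈ 𝓝 p) :
    ∃ φ : OpenPartialHomeomorph C2 (Fin 4 → ℝ), IsSmoothChart φ ∧ p ∈ φ.source ∧
      φ.source ⊆ U ∧ (φ : C2 → Fin 4 → ℝ) = Φ := by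
  have hrank : Module.finrank ℝ C2 = Module.finrank ℝ (Fin 4 → ℝ) := by
    rw [← Module.finrank_mul_finrank ℝ ℂ C2]
    simp [Complex.finrank_real_complex]
  let e : C2 ≃L[ℝ] (Fin 4 → ℝ) := (LinearMap.linearEquivOfInjective (Φ' : C2 →ₗ[ℝ] (Fin 4 → ℝ))
    (LinearMap.ker_eq_bot.1 (LinearMap.ker_eq_bot'.2 hinj)) hrank).toContinuousLinearEquiv
  have he : (e : C2 →L[ℝ] (Fin 4 → ℝ)) = Φ' := by
    ext v i
    rfl
  have hne : (∞ : WithTop ℕ∞) ≠ 0 := by simp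
  let φ₀ := hΦ.contDiffAt.toOpenPartialHomeomorph Φ (f' := e) (he ▸ hΦ') hne
  let V : Set C2 := {q | fderiv ℝ Φ q ∈ Set.range
    ((↑) : (C2 ≃L[ℝ] (Fin 4 → ℝ)) → C2 →L[ℝ] (Fin 4 → ℝ))}
  have hV : IsOpen V := ContinuousLinearEquiv.isOpen.preimage (hΦ.continuous_fderiv hne)
  have hpV : p ∈ V := ⟨e, by rw [he, hΦ'.fderiv]⟩
  refine ⟨φ₀.restrOpen (interior U ∩ V) (isOpen_interior.inter hV), ⟨?_, ?_⟩, ?_, ?_, rfl⟩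
  · exact hΦ.contDiffOn
  · intro y hy
    set φ := φ₀.restrOpen (interior U ∩ V) (isOpen_interior.inter hV)
    have hq : φ.symm y ∈ φ.source := φ.map_target hy
    rw [OpenPartialHomeomorph.restrOpen_source] at hq
    obtain ⟨e', he'⟩ := hq.2.2
    refine (φ.contDiffAt_symm (f₀' := e') hy ?_ hΦ.contDiffAt).contDiffWithinAt
    rw [he']
    exact (hΦ.differentiable hne _).hasFDerivAt
  · rw [OpenPartialHomeomorph.restrOpen_source]
    exact ⟨hΦ.contDiffAt.mem_toOpenPartialHomeomorph_source _ _,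
      mem_interior_iff_mem_nhds.2 hU, hpV⟩
  · rw [OpenPartialHomeomorph.restrOpen_source]
    exact fun q hq => interior_subset hq.2.1

section SmoothChart

variable {φ : OpenPartialHomeomorph C2 (Fin 4 → ℝ)} {q : C2} {S : Set C2}

lemma IsSmoothChart.hasFDerivAt (hφ : IsSmoothChart φ) (hq : q ∈ φ.source) :
    HasFDerivAt φ (fderiv ℝ φ q) q :=
  ((hφ.1.contDiffAt (φ.open_source.mem_nhds hq)).differentiableAt (by simp)).hasFDerivAt

lemma IsSmoothChart.hasFDerivAt_symm (hφ : IsSmoothChart φ) (hq : q ∈ φ.source) :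
    HasFDerivAt φ.symm (fderiv ℝ φ.symm (φ q)) (φ q) :=
  ((hφ.2.contDiffAt (φ.open_target.mem_nhds (φ.map_source hq))).differentiableAt
    (by simp)).hasFDerivAt

lemma IsSmoothChart.fderiv_symm_fderiv (hφ : IsSmoothChart φ) (hq : q ∈ φ.source) (v : C2) :
    fderiv ℝ φ.symm (φ q) (fderiv ℝ φ q v) = v := by
  have h1 := (hφ.hasFDerivAt_symm hq).comp q (hφ.hasFDerivAt hq)
  have h2 : HasFDerivAt (φ.symm ∘ φ) (ContinuousLinearMap.id ℝ C2) q :=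
    (hasFDerivAt_id q).congr_of_eventuallyEq (φ.eventually_left_inverse hq)
  exact congrArg (fun L : C2 →L[ℝ] C2 => L v) (h1.unique h2)

lemma IsSmoothChart.fderiv_fderiv_symm (hφ : IsSmoothChart φ) (hq : q ∈ φ.source)
    (w : Fin 4 → ℝ) : fderiv ℝ φ q (fderiv ℝ φ.symm (φ q) w) = w := by
  have h0 : HasFDerivAt φ (fderiv ℝ φ q) (φ.symm (φ q)) := by
    rw [φ.left_inv hq]
    exact hφ.hasFDerivAt hq
  have h1 := h0.comp (φ q) (hφ.hasFDerivAt_symm hq)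
  have h2 : HasFDerivAt (φ ∘ φ.symm) (ContinuousLinearMap.id ℝ (Fin 4 → ℝ)) (φ q) :=
    (hasFDerivAt_id (φ q)).congr_of_eventuallyEq
      (φ.eventually_right_inverse (φ.map_source hq))
  exact congrArg (fun L : (Fin 4 → ℝ) →L[ℝ] (Fin 4 → ℝ) => L w) (h1.unique h2)

lemma IsSmoothChart.fderiv_coordField (hφ : IsSmoothChart φ) (hq : q ∈ φ.source) (j : Fin 4) :
    fderiv ℝ φ q (coordField φ j q) = Pi.single j 1 :=
  hφ.fderiv_fderiv_symm hq _

lemma IsSmoothChart.fderiv_injective (hφ : IsSmoothChart φ) (hq : q ∈ φ.source) :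
    Function.Injective (fderiv ℝ φ q) :=
  Function.LeftInverse.injective (hφ.fderiv_symm_fderiv hq)

/-- Every vector is the combination of the coordinate fields with the coefficients given by the
derivative of the chart. -/
lemma IsSmoothChart.eq_sum_coordField (hφ : IsSmoothChart φ) (hq : q ∈ φ.source) (v : C2) :
    v = fderiv ℝ φ q v 0 • coordField φ 0 q + fderiv ℝ φ q v 1 • coordField φ 1 q +
      fderiv ℝ φ q v 2 • coordField φ 2 q + fderiv ℝ φ q v 3 • coordField φ 3 q := by
  apply hφ.fderiv_injective hq
  simp only [map_add, map_smul, hφ.fderiv_coordField hq]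
  ext j
  fin_cases j <;> simp

/-- Velocities at a boundary point of curves that enter the surface: they lie in the closed half
plane on the inner side of the boundary. -/
lemma IsBoundaryChart.fderiv_of_eventually (hφ : IsBoundaryChart S φ) (hpS : p ∈ S)
    (hp : p ∈ φ.source) (hp0 : φ p 0 = 0) {γ : ℝ → C2} {v : C2} (h0 : γ 0 = p)
    (hγ : HasDerivAt γ v 0) (hS : ∀ᶠ t in 𝓝[>] 0, γ t ∈ S) :
    fderiv ℝ φ p v 0 ≤ 0 ∧ fderiv ℝ φ p v 2 = 0 ∧ fderiv ℝ φ p v 3 = 0 := by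
  have hd : HasDerivAt (φ ∘ γ) (fderiv ℝ φ p v) 0 := by
    subst h0
    exact (hφ.1.hasFDerivAt hp).comp_hasDerivAt 0 hγ
  have hsrc : ∀ᶠ t in 𝓝[>] (0 : ℝ), γ t ∈ φ.source := by
    refine (hγ.continuousAt.eventually_mem (φ.open_source.mem_nhds ?_)).filter_mono
      nhdsWithin_le_nhds
    rwa [h0]
  have hslope : ∀ j, Tendsto (fun t => t⁻¹ * (φ (γ t) j - φ p j)) (𝓝[>] 0)
      (𝓝 (fderiv ℝ φ p v j)) := by
    intro j
    have h1 := (hasDerivAt_pi.1 hd j).tendsto_slope_zero_right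
    simpa [h0] using h1
  have hpj := (hφ.2 p hp).1 hpS
  refine ⟨le_of_tendsto (hslope 0) ?_, tendsto_nhds_unique (hslope 2) ?_,
    tendsto_nhds_unique (hslope 3) ?_⟩
  · filter_upwards [hS, hsrc, self_mem_nhdsWithin] with t h1 h2 h3
    have := ((hφ.2 _ h2).1 h1).2.2
    rw [hp0, sub_zero]
    exact mul_nonpos_of_nonneg_of_nonpos (inv_nonneg.2 (le_of_lt h3)) this
  · refine tendsto_const_nhds.congr' ?_
    filter_upwards [hS, hsrc] with t h1 h2
    rw [((hφ.2 _ h2).1 h1).1, hpj.1, sub_zero, mul_zero]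
  · refine tendsto_const_nhds.congr' ?_
    filter_upwards [hS, hsrc] with t h1 h2
    rw [((hφ.2 _ h2).1 h1).2.1, hpj.2.1, sub_zero, mul_zero]

/-- The tangent vectors of a surface at a boundary point are tangent to the boundary. -/
lemma IsBoundaryChart.fderiv_of_mem_tangentVectors (hφ : IsBoundaryChart S φ) (hpS : p ∈ S)
    (hp : p ∈ φ.source) (hp0 : φ p 0 = 0) {v : C2} (hv : v ∈ tangentVectors S p) :
    fderiv ℝ φ p v = Pi.single 1 (fderiv ℝ φ p v 1) := by
  obtain ⟨γ, h0, hγ, hS⟩ := hv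
  have h1 := hφ.fderiv_of_eventually hpS hp hp0 h0 hγ (hS.filter_mono nhdsWithin_le_nhds)
  have hneg : HasDerivAt (fun t => γ (-t)) (-v) 0 := by
    have hγ' : HasDerivAt γ v (-0) := by rwa [neg_zero]
    have h := hγ'.scomp (0 : ℝ) (hasDerivAt_neg 0)
    rwa [neg_one_smul] at h
  have hSn : ∀ᶠ t in 𝓝 (0 : ℝ), γ (-t) ∈ S := by
    have : Tendsto (fun t : ℝ => -t) (𝓝 0) (𝓝 0) := by
      simpa using (continuous_neg.tendsto (0 : ℝ))
    exact this.eventually hS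
  have h2 := hφ.fderiv_of_eventually hpS hp hp0 (γ := fun t => γ (-t)) (by simpa using h0) hneg
    (hSn.filter_mono nhdsWithin_le_nhds)
  rw [map_neg] at h2
  have h3 : fderiv ℝ φ p v 0 = 0 := le_antisymm h1.1 (by simpa using h2.1)
  ext j
  fin_cases j <;> simp [h1.2.1, h1.2.2, h3]

lemma IsInteriorChart.coordField_mem_tangentVectors (hφ : IsInteriorChart S φ) (hpS : p ∈ S)
    (hp : p ∈ φ.source) {j : Fin 4} (hj2 : j ≠ 2) (hj3 : j ≠ 3) :
    coordField φ j p ∈ tangentVectors S p := by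
  have hline : HasDerivAt (fun t : ℝ => φ p + t • (Pi.single j 1 : Fin 4 → ℝ))
      (Pi.single j 1) 0 := by
    simpa using ((hasDerivAt_id (0 : ℝ)).smul_const (Pi.single j 1 : Fin 4 → ℝ)).const_add (φ p)
  refine ⟨fun t => φ.symm (φ p + t • (Pi.single j 1 : Fin 4 → ℝ)), ?_, ?_, ?_⟩
  · simpa using φ.left_inv hp
  · have h0 : HasFDerivAt φ.symm (fderiv ℝ φ.symm (φ p))
        (φ p + (0 : ℝ) • (Pi.single j 1 : Fin 4 → ℝ)) := by
      simpa using hφ.1.hasFDerivAt_symm hp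
    exact h0.comp_hasDerivAt (0 : ℝ) hline
  · have htgt : ∀ᶠ t in 𝓝 (0 : ℝ), φ p + t • (Pi.single j 1 : Fin 4 → ℝ) ∈ φ.target := by
      refine hline.continuousAt.eventually_mem (φ.open_target.mem_nhds ?_)
      simpa using φ.map_source hp
    filter_upwards [htgt] with t ht
    have hp' := (hφ.2 p hp).1 hpS
    rw [hφ.2 _ (φ.map_target ht), φ.right_inv ht]
    simp [hp'.1, hp'.2, hj2.symm, hj3.symm]

/-- A point of a surface is not both an interior point and a boundary point: the tangent vectors
contain a plane in the first case and lie on a line in the second. -/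
lemma notMem_surfaceInterior_of_mem_surfaceBoundary (hb : p ∈ surfaceBoundary S) :
    p ∉ surfaceInterior S := by
  rintro ⟨hpS, ψ, hψ, hpψ⟩
  obtain ⟨-, φ, hφ, hpφ, hp0⟩ := hb
  have h0 := hφ.fderiv_of_mem_tangentVectors hpS hpφ hp0
    (hψ.coordField_mem_tangentVectors hpS hpψ (j := 0) (by decide) (by decide))
  have h1 := hφ.fderiv_of_mem_tangentVectors hpS hpφ hp0
    (hψ.coordField_mem_tangentVectors hpS hpψ (j := 1) (by decide) (by decide))
  set a := fderiv ℝ φ p (coordField ψ 0 p) 1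
  set b := fderiv ℝ φ p (coordField ψ 1 p) 1
  have hcomb : b • coordField ψ 0 p = a • coordField ψ 1 p := by
    apply hφ.1.fderiv_injective hpφ
    rw [map_smul, map_smul, h0, h1]
    ext j
    fin_cases j <;> simp [mul_comm]
  have hcomb' := congrArg (fderiv ℝ ψ p) hcomb
  rw [map_smul, map_smul, hψ.1.fderiv_coordField hpψ, hψ.1.fderiv_coordField hpψ] at hcomb'
  have ha : a = 0 := by simpa using (congrFun hcomb' 1).symm
  rw [ha, Pi.single_zero] at h0
  have hz : coordField ψ 0 p = 0 := hφ.1.fderiv_injective hpφ (by rw [h0, map_zero])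
  have := hψ.1.fderiv_coordField hpψ 0
  rw [hz, map_zero] at this
  simpa using congrFun this 0

end SmoothChart

/-! ### The orientation of `ℂ²` -/

lemma det4_eq (u v w x : C2) : det4 u v w x =
    ((u 0).re * (v 0).im - (u 0).im * (v 0).re) * ((w 1).re * (x 1).im - (w 1).im * (x 1).re) -
    ((u 0).re * (w 0).im - (u 0).im * (w 0).re) * ((v 1).re * (x 1).im - (v 1).im * (x 1).re) +
    ((u 0).re * (x 0).im - (u 0).im * (x 0).re) * ((v 1).re * (w 1).im - (v 1).im * (w 1).re) +
    ((v 0).re * (w 0).im - (v 0).im * (w 0).re) * ((u 1).re * (x 1).im - (u 1).im * (x 1).re) -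
    ((v 0).re * (x 0).im - (v 0).im * (x 0).re) * ((u 1).re * (w 1).im - (u 1).im * (w 1).re) +
    ((w 0).re * (x 0).im - (w 0).im * (x 0).re) * ((u 1).re * (v 1).im - (u 1).im * (v 1).re) := by
  simp [det4, Matrix.det_succ_row_zero, Fin.sum_univ_succ, Fin.succAbove]
  ring

lemma det4_smul_add_smul (u v w x : C2) (a b : ℝ) :
    det4 u v w (a • w + b • x) = b * det4 u v w x := by
  simp only [det4_eq, PiLp.add_apply, PiLp.smul_apply, Complex.add_re, Complex.add_im,
    Complex.smul_re, Complex.smul_im, smul_eq_mul]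
  ring

lemma det4_linear_first (u v w x : C2) (a b c e : ℝ) :
    det4 (a • v + b • w + c • x + e • u) v w x = e * det4 u v w x := by
  simp only [det4_eq, PiLp.add_apply, PiLp.smul_apply, Complex.add_re, Complex.add_im,
    Complex.smul_re, Complex.smul_im, smul_eq_mul]
  ring

/-- A change of basis by a matrix with determinant `e * c`. -/
lemma det4_change_basis (u v w x : C2) (a b c e s t : ℝ) :
    det4 (e • u) (c • w) (-v + a • w + b • u) (s • w + x + t • u) = e * c * det4 u v w x := by
  simp only [det4_eq, PiLp.add_apply, PiLp.smul_apply, PiLp.neg_apply, Complex.add_re,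
    Complex.add_im, Complex.neg_re, Complex.neg_im, Complex.smul_re, Complex.smul_im, smul_eq_mul]
  ring

/-- Complex bases are positively oriented. -/
lemma det4_smul_I (u v : C2) : det4 u (Complex.I • u) v (Complex.I • v) =
    Complex.normSq (u 0 * v 1 - u 1 * v 0) := by
  simp only [det4_eq, PiLp.smul_apply, smul_eq_mul, Complex.normSq_apply, Complex.sub_re,
    Complex.sub_im, Complex.mul_re, Complex.mul_im, Complex.I_re, Complex.I_im]
  ring

lemma continuousAt_det4 {Y : Type*} [TopologicalSpace Y] {u v w x : Y → C2} {y : Y}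
    (hu : ContinuousAt u y) (hv : ContinuousAt v y) (hw : ContinuousAt w y)
    (hx : ContinuousAt x y) : ContinuousAt (fun y => det4 (u y) (v y) (w y) (x y)) y := by
  have h : ∀ {g : Y → C2}, ContinuousAt g y → ∀ i,
      ContinuousAt (fun y => (g y i).re) y ∧ ContinuousAt (fun y => (g y i).im) y :=
    fun hg i => ⟨(contDiff_coord i).1.continuous.continuousAt.comp hg,
      (contDiff_coord i).2.continuous.continuousAt.comp hg⟩
  have hu0 := h hu 0; have hu1 := h hu 1; have hv0 := h hv 0; have hv1 := h hv 1
  have hw0 := h hw 0; have hw1 := h hw 1; have hx0 := h hx 0; have hx1 := h hx 1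
  simp only [det4_eq]
  exact ((((((hu0.1.mul hv0.2).sub (hu0.2.mul hv0.1)).mul
    ((hw1.1.mul hx1.2).sub (hw1.2.mul hx1.1))).sub
    (((hu0.1.mul hw0.2).sub (hu0.2.mul hw0.1)).mul
    ((hv1.1.mul hx1.2).sub (hv1.2.mul hx1.1)))).add
    (((hu0.1.mul hx0.2).sub (hu0.2.mul hx0.1)).mul
    ((hv1.1.mul hw1.2).sub (hv1.2.mul hw1.1)))).add
    (((hv0.1.mul hw0.2).sub (hv0.2.mul hw0.1)).mul
    ((hu1.1.mul hx1.2).sub (hu1.2.mul hx1.1)))).sub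
    (((hv0.1.mul hx0.2).sub (hv0.2.mul hx0.1)).mul
    ((hu1.1.mul hw1.2).sub (hu1.2.mul hw1.1))) |>.add
    (((hw0.1.mul hx0.2).sub (hw0.2.mul hx0.1)).mul
    ((hu1.1.mul hv1.2).sub (hu1.2.mul hv1.1)))

lemma IsSmoothChart.continuousAt_coordField {φ : OpenPartialHomeomorph C2 (Fin 4 → ℝ)} {q : C2}
    (hφ : IsSmoothChart φ) (hq : q ∈ φ.source) (j : Fin 4) : ContinuousAt (coordField φ j) q := by
  have h1 : ContinuousAt (fderiv ℝ φ.symm) (φ q) :=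
    (hφ.2.continuousOn_fderiv_of_isOpen φ.open_target (by simp)).continuousAt
      (φ.open_target.mem_nhds (φ.map_source hq))
  exact (ContinuousAt.comp (f := φ) h1 (φ.continuousAt hq)).clm_apply continuousAt_const

/-! ### The surface at points where `f` is positive -/

/-- The complex determinant `v ↦ det (u, v)` on `ℂ²`. -/
noncomputable def cdet (u : C2) : C2 →L[ℂ] ℂ :=
  u 0 • (EuclideanSpace.proj 1 : C2 →L[ℂ] ℂ) - u 1 • (EuclideanSpace.proj 0 : C2 →L[ℂ] ℂ)

lemma cdet_apply (u v : C2) : cdet u v = u 0 * v 1 - u 1 * v 0 := by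
  simp [cdet]

lemma exists_smul_eq_of_cdet_eq_zero {u v : C2} (hu : u ≠ 0) (h : cdet u v = 0) :
    ∃ c : ℂ, v = c • u := by
  rw [cdet_apply, sub_eq_zero] at h
  by_cases h0 : u 0 = 0
  · have h1 : u 1 ≠ 0 := by
      intro h1
      apply hu
      ext i
      fin_cases i <;> simp [h0, h1]
    refine ⟨v 1 / u 1, ?_⟩
    have hv : v 0 = 0 := by
      rw [h0, zero_mul] at h
      exact (mul_eq_zero.1 h.symm).resolve_left h1
    ext i
    fin_cases i
    · simp [h0, hv]
    · simp [h1]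
  · refine ⟨v 0 / u 0, ?_⟩
    ext i
    fin_cases i
    · simp [h0]
    · simp only [Fin.mk_one, PiLp.smul_apply, smul_eq_mul]
      field_simp
      rw [mul_comm, h, mul_comm]

lemma eq_smul_add_smul_I (c : ℂ) (u : C2) : c • u = c.re • u + c.im • (Complex.I • u) := by
  ext i
  simp only [PiLp.smul_apply, PiLp.add_apply, smul_eq_mul, Complex.real_smul]
  conv_lhs => rw [← Complex.re_add_im c]
  ring

lemma reInner_smul_eulerField (c : ℂ) (p : C2) :
    reInner p (c • eulerField α p) = c.re * reInner p (eulerField α p) := by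
  rw [eq_smul_add_smul_I, map_add, map_smul, map_smul, reInner_smul_I_eulerField]
  simp

lemma posLocus_subset_surfaceInterior (hα : ∀ i, 0 < α i) (hd : 0 < d)
    (hf : IsWeightedHomogeneous α f d) : posLocus f ⊆ surfaceInterior (nonnegLocus f) := by
  intro p hp
  have hp0 := ne_zero_of_mem_S3 hp.1
  have hE := eulerField_ne_zero hα hp0
  let η : C2 →L[ℝ] ℂ := (cdet (eulerField α p)).restrictScalars ℝ
  let Φ : C2 → Fin 4 → ℝ := fun z => ![(η z).re, (η z).im, (polyFun f z).im, sqNorm z - 1]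
  let D : C2 →L[ℝ] (Fin 4 → ℝ) := ContinuousLinearMap.pi
    ![Complex.reCLM.comp η, Complex.imCLM.comp η,
      Complex.imCLM.comp ((polyDeriv f p).restrictScalars ℝ), (2 : ℝ) • reInner p]
  have hΦ : ContDiff ℝ ∞ Φ := by
    rw [contDiff_pi]
    intro i
    fin_cases i
    · exact Complex.reCLM.contDiff.comp η.contDiff
    · exact Complex.imCLM.contDiff.comp η.contDiff
    · exact Complex.imCLM.contDiff.comp (contDiff_polyFun f)
    · exact contDiff_sqNorm.sub contDiff_const
  have hD : HasFDerivAt Φ D p := by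
    rw [hasFDerivAt_pi]
    intro i
    fin_cases i
    · exact Complex.reCLM.hasFDerivAt.comp p η.hasFDerivAt
    · exact Complex.imCLM.hasFDerivAt.comp p η.hasFDerivAt
    · exact Complex.imCLM.hasFDerivAt.comp p (hasFDerivAt_polyFun_real f p)
    · exact (hasFDerivAt_sqNorm p).sub_const 1
  have hinj : ∀ v, D v = 0 → v = 0 := by
    intro v hv
    have h0 : (η v).re = 0 := congrFun hv 0
    have h1 : (η v).im = 0 := congrFun hv 1
    have h2 : (polyDeriv f p v).im = 0 := congrFun hv 2
    have h3 : 2 * reInner p v = 0 := congrFun hv 3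
    obtain ⟨c, rfl⟩ := exists_smul_eq_of_cdet_eq_zero hE (Complex.ext h0 h1 : η v = 0)
    have hfp : polyFun f p = ((polyFun f p).re : ℂ) := Complex.ext rfl hp.2.1
    rw [map_smul, polyDeriv_eulerField hf, hfp, smul_eq_mul, ← mul_assoc,
      Complex.im_mul_ofReal] at h2
    have hd' : (d : ℝ) ≠ 0 := by exact_mod_cast hd.ne'
    have him : c.im = 0 := by simpa [hd', hp.2.2.ne'] using h2
    rw [reInner_smul_eulerField] at h3
    have hre : c.re = 0 := by simpa [(reInner_eulerField_pos hα hp0).ne'] using h3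
    rw [Complex.ext (w := 0) hre him, zero_smul]
  have hU : {z | 0 < (polyFun f z).re} ∈ 𝓝 p :=
    (isOpen_lt continuous_const (Complex.continuous_re.comp (continuous_polyFun f))).mem_nhds
      hp.2.2
  obtain ⟨φ, hφ, hpφ, hφU, hφΦ⟩ := exists_isSmoothChart hΦ hD hinj hU
  refine ⟨posLocus_subset_nonnegLocus f hp, φ, ⟨hφ, fun q hq => ?_⟩, hpφ⟩
  rw [hφΦ]
  have hre : 0 < (polyFun f q).re := hφU hq
  change _ ∧ _ ∧ _ ↔ (polyFun f q).im = 0 ∧ sqNorm q - 1 = 0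
  rw [mem_S3_iff, sub_eq_zero]
  constructor
  · exact fun h => ⟨h.2.1, h.1⟩
  · exact fun h => ⟨h.2, h.1, hre.le⟩

/-- The flow is transverse to the surface where `f` is positive, because it rotates the values
of `f`. -/
lemma flowField_notMem_tangentVectors (hd : 0 < d) (hf : IsWeightedHomogeneous α f d)
    (hp : p ∈ posLocus f) : flowField α p ∉ tangentVectors (nonnegLocus f) p := by
  rintro ⟨γ, h0, hγ, hS⟩
  have h1 : HasFDerivAt (fun z => (polyFun f z).im)
      (Complex.imCLM.comp ((polyDeriv f p).restrictScalars ℝ)) (γ 0) := by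
    rw [h0]
    exact Complex.imCLM.hasFDerivAt.comp p (hasFDerivAt_polyFun_real f p)
  have h2 := h1.comp_hasDerivAt (0 : ℝ) hγ
  have h3 : HasDerivAt ((fun z => (polyFun f z).im) ∘ γ) 0 0 :=
    (hasDerivAt_const (0 : ℝ) (0 : ℝ)).congr_of_eventuallyEq (hS.mono fun t ht => ht.2.1)
  have h4 : (polyDeriv f p (flowField α p)).im = 0 := h2.unique h3
  rw [flowField_eq, map_smul, polyDeriv_eulerField hf, smul_eq_mul, Complex.I_mul_im] at h4
  have hd' : (d : ℝ) ≠ 0 := by exact_mod_cast hd.ne'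
  simp [hd', hp.2.2.ne'] at h4

/-! ### The surface at non-degenerate zeros of `f` -/

lemma reInner_self (u : C2) : reInner u u = sqNorm u := by
  simp [reInner_apply, sqNorm, Complex.normSq_apply]

lemma reInner_smul_I_self (u : C2) : reInner (Complex.I • u) u = 0 := by
  rw [reInner_apply]
  refine Finset.sum_eq_zero fun i _ => ?_
  simp
  ring

lemma sqNorm_pos {u : C2} (hu : u ≠ 0) : 0 < sqNorm u := by
  rw [sqNorm_eq]
  positivity

/-- The kernel of a nonzero linear form on `ℂ²` is a line. -/
lemma cdet_eq_zero_of_polyDeriv {u v : C2} (hf : polyDeriv f p ≠ 0) (hu : polyDeriv f p u = 0)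
    (hv : polyDeriv f p v = 0) : cdet u v = 0 := by
  rw [polyDeriv_apply, Fin.sum_univ_two] at hu hv
  rw [cdet_apply]
  by_contra hne
  apply hf
  have h0 : polyFun (pderiv 0 f) p = 0 :=
    (mul_eq_zero.1 (show polyFun (pderiv 0 f) p * (u 0 * v 1 - u 1 * v 0) = 0 by
      linear_combination v 1 * hu - u 1 * hv)).resolve_right hne
  have h1 : polyFun (pderiv 1 f) p = 0 :=
    (mul_eq_zero.1 (show polyFun (pderiv 1 f) p * (u 0 * v 1 - u 1 * v 0) = 0 by
      linear_combination u 0 * hv - v 0 * hu)).resolve_right hne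
  ext v
  simp [polyDeriv_apply, h0, h1]

/-- At a non-degenerate zero `p` of `f` the functions `-Re f`, `Im f` and `|z|² - 1`, together
with the linear form dual to the flow direction at `p`, are the coordinates of a boundary chart.
The flow is `∂₁` at `p`, up to a positive factor, and elsewhere on the surface it is a combination
of `∂₁` and `(d f) ∂₂`; this gives the orientation. -/
lemma exists_positive_boundaryChart (hα : ∀ i, 0 < α i) (hd : 0 < d)
    (hf : IsWeightedHomogeneous α f d) (hp : p ∈ zeroLocus f) (hdf : polyDeriv f p ≠ 0) :
    ∃ φ, IsBoundaryChart (nonnegLocus f) φ ∧ p ∈ φ.source ∧ φ p 0 = 0 ∧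
      (∀ q ∈ φ.source ∩ posLocus f,
        0 < det4 q (coordField φ 0 q) (coordField φ 1 q) (flowField α q)) ∧
      ∃ c : ℝ, 0 < c ∧ flowField α p = c • coordField φ 1 p := by
  have hp0 := ne_zero_of_mem_S3 hp.1
  set E := eulerField α p with hEdef
  have hE : E ≠ 0 := eulerField_ne_zero hα hp0
  have hfE : polyDeriv f p E = 0 := by rw [hEdef, polyDeriv_eulerField hf, hp.2, mul_zero]
  let Φ : C2 → Fin 4 → ℝ :=
    fun z => ![-(polyFun f z).re, reInner (flowField α p) z, (polyFun f z).im, sqNorm z - 1]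
  let D : C2 → C2 →L[ℝ] (Fin 4 → ℝ) := fun q => ContinuousLinearMap.pi
    ![-Complex.reCLM.comp ((polyDeriv f q).restrictScalars ℝ), reInner (flowField α p),
      Complex.imCLM.comp ((polyDeriv f q).restrictScalars ℝ), (2 : ℝ) • reInner q]
  have hΦ : ContDiff ℝ ∞ Φ := by
    rw [contDiff_pi]
    intro i
    fin_cases i
    · exact (Complex.reCLM.contDiff.comp (contDiff_polyFun f)).neg
    · exact (reInner (flowField α p)).contDiff
    · exact Complex.imCLM.contDiff.comp (contDiff_polyFun f)
    · exact contDiff_sqNorm.sub contDiff_const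
  have hD : ∀ q, HasFDerivAt Φ (D q) q := by
    intro q
    rw [hasFDerivAt_pi]
    intro i
    fin_cases i
    · exact (Complex.reCLM.hasFDerivAt.comp q (hasFDerivAt_polyFun_real f q)).neg
    · exact (reInner (flowField α p)).hasFDerivAt
    · exact Complex.imCLM.hasFDerivAt.comp q (hasFDerivAt_polyFun_real f q)
    · exact (hasFDerivAt_sqNorm q).sub_const 1
  have hXE : ∀ c : ℂ, reInner (flowField α p) (c • E) = c.im * sqNorm (Complex.I • E) := by
    intro c
    rw [flowField_eq, eq_smul_add_smul_I c E, map_add, map_smul, map_smul, reInner_smul_I_self,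
      reInner_self]
    simp [hEdef]
  have hIE : 0 < sqNorm (Complex.I • E) := sqNorm_pos (smul_ne_zero Complex.I_ne_zero hE)
  have hinj : ∀ v, D p v = 0 → v = 0 := by
    intro v hv
    have h0 : -(polyDeriv f p v).re = 0 := congrFun hv 0
    have h1 : reInner (flowField α p) v = 0 := congrFun hv 1
    have h2 : (polyDeriv f p v).im = 0 := congrFun hv 2
    have h3 : 2 * reInner p v = 0 := congrFun hv 3
    obtain ⟨c, rfl⟩ := exists_smul_eq_of_cdet_eq_zero hE
      (cdet_eq_zero_of_polyDeriv hdf hfE (Complex.ext (neg_eq_zero.1 h0) h2))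
    rw [hXE] at h1
    have him : c.im = 0 := by simpa [hIE.ne'] using h1
    rw [hEdef, reInner_smul_eulerField] at h3
    have hre : c.re = 0 := by simpa [(reInner_eulerField_pos hα hp0).ne'] using h3
    rw [Complex.ext (w := 0) hre him, zero_smul]
  obtain ⟨φ₀, hφ₀, hpφ₀, -, hφ₀Φ⟩ := exists_isSmoothChart hΦ (hD p) hinj univ_mem
  have hD₀ : ∀ q, fderiv ℝ φ₀ q = D q := fun q => by rw [hφ₀Φ, (hD q).fderiv]
  -- The flow direction in the chart.
  have hX : flowField α p = sqNorm (Complex.I • E) • coordField φ₀ 1 p := by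
    conv_lhs => rw [hφ₀.eq_sum_coordField hpφ₀ (flowField α p)]
    have h0 : D p (flowField α p) 0 = 0 := by
      change -(polyDeriv f p (flowField α p)).re = 0
      rw [flowField_eq, map_smul, ← hEdef, hfE, smul_zero, Complex.zero_re, neg_zero]
    have h1 : D p (flowField α p) 1 = sqNorm (Complex.I • E) := by
      change reInner (flowField α p) (flowField α p) = _
      rw [reInner_self, flowField_eq]
    have h2 : D p (flowField α p) 2 = 0 := by
      change (polyDeriv f p (flowField α p)).im = 0
      rw [flowField_eq, map_smul, ← hEdef, hfE, smul_zero, Complex.zero_im]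
    have h3 : D p (flowField α p) 3 = 0 := by
      change 2 * reInner p (flowField α p) = 0
      rw [flowField_eq, reInner_smul_I_eulerField, mul_zero]
    rw [hD₀, h0, h1, h2, h3]
    simp
  have hXq : ∀ q ∈ φ₀.source ∩ posLocus f, ∃ a : ℝ, flowField α q =
      a • coordField φ₀ 1 q + (d * (polyFun f q).re) • coordField φ₀ 2 q := by
    rintro q ⟨hq, hq1, hq2, hq3⟩
    refine ⟨D q (flowField α q) 1, ?_⟩
    conv_lhs => rw [hφ₀.eq_sum_coordField hq (flowField α q)]
    have h0 : D q (flowField α q) 0 = 0 := by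
      change -(polyDeriv f q (flowField α q)).re = 0
      rw [flowField_eq, map_smul, polyDeriv_eulerField hf, smul_eq_mul, Complex.I_mul_re]
      simp [hq2]
    have h2 : D q (flowField α q) 2 = d * (polyFun f q).re := by
      change (polyDeriv f q (flowField α q)).im = _
      rw [flowField_eq, map_smul, polyDeriv_eulerField hf, smul_eq_mul, Complex.I_mul_im]
      simp
    have h3 : D q (flowField α q) 3 = 0 := by
      change 2 * reInner q (flowField α q) = 0
      rw [flowField_eq, reInner_smul_I_eulerField, mul_zero]
    rw [hD₀, h0, h2, h3]
    simp
  -- The orientation of the chart at `p` is computed in the complex basis `E, V`.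
  let G : C2 → ℝ := fun q => det4 q (coordField φ₀ 0 q) (coordField φ₀ 1 q) (coordField φ₀ 2 q)
  have hGp : 0 < G p := by
    obtain ⟨w, hw⟩ : ∃ w, polyDeriv f p w ≠ 0 := by
      by_contra! h
      exact hdf (ContinuousLinearMap.ext h)
    set V := (polyDeriv f p w)⁻¹ • w
    have hfV : polyDeriv f p V = 1 := by
      rw [map_smul, smul_eq_mul, inv_mul_cancel₀ hw]
    have hfIV : polyDeriv f p (Complex.I • V) = Complex.I := by
      rw [map_smul, hfV, smul_eq_mul, mul_one]
    have hEV : cdet E V ≠ 0 := by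
      intro h
      obtain ⟨c, hc⟩ := exists_smul_eq_of_cdet_eq_zero hE h
      rw [hc, map_smul, hfE, smul_zero] at hfV
      exact zero_ne_one hfV
    have e1 : E = (2 * reInner p E) • coordField φ₀ 3 p := by
      conv_lhs => rw [hφ₀.eq_sum_coordField hpφ₀ E]
      have h0 : D p E 0 = 0 := by
        change -(polyDeriv f p E).re = 0
        rw [hfE, Complex.zero_re, neg_zero]
      have h1 : D p E 1 = 0 := by
        change reInner (flowField α p) E = 0
        rw [flowField_eq, reInner_smul_I_self]
      have h2 : D p E 2 = 0 := by
        change (polyDeriv f p E).im = 0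
        rw [hfE, Complex.zero_im]
      have h3 : D p E 3 = 2 * reInner p E := rfl
      rw [hD₀, h0, h1, h2, h3]
      simp
    have e2 : Complex.I • E = sqNorm (Complex.I • E) • coordField φ₀ 1 p := by
      rw [← hX, flowField_eq]
    have e3 : V = -coordField φ₀ 0 p + D p V 1 • coordField φ₀ 1 p +
        D p V 3 • coordField φ₀ 3 p := by
      conv_lhs => rw [hφ₀.eq_sum_coordField hpφ₀ V]
      have h0 : D p V 0 = -1 := by
        change -(polyDeriv f p V).re = -1
        rw [hfV, Complex.one_re]
      have h2 : D p V 2 = 0 := by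
        change (polyDeriv f p V).im = 0
        rw [hfV, Complex.one_im]
      rw [hD₀, h0, h2]
      simp
    have e4 : Complex.I • V = D p (Complex.I • V) 1 • coordField φ₀ 1 p + coordField φ₀ 2 p +
        D p (Complex.I • V) 3 • coordField φ₀ 3 p := by
      conv_lhs => rw [hφ₀.eq_sum_coordField hpφ₀ (Complex.I • V)]
      have h0 : D p (Complex.I • V) 0 = 0 := by
        change -(polyDeriv f p (Complex.I • V)).re = 0
        rw [hfIV, Complex.I_re, neg_zero]
      have h2 : D p (Complex.I • V) 2 = 1 := by
        change (polyDeriv f p (Complex.I • V)).im = 1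
        rw [hfIV, Complex.I_im]
      rw [hD₀, h0, h2]
      simp
    have e5 : G p = 2 * det4 (coordField φ₀ 3 p) (coordField φ₀ 0 p) (coordField φ₀ 1 p)
        (coordField φ₀ 2 p) := by
      have h3 : D p p 3 = 2 := by
        change 2 * reInner p p = 2
        rw [reInner_self, mem_S3_iff.1 hp.1, mul_one]
      change det4 p _ _ _ = _
      rw [← det4_linear_first _ _ _ _ (D p p 0) (D p p 1) (D p p 2) 2]
      congr 1
      conv_lhs => rw [hφ₀.eq_sum_coordField hpφ₀ p, hD₀, h3]
    have e6 := det4_smul_I E V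
    have e7 := det4_change_basis (coordField φ₀ 3 p) (coordField φ₀ 0 p) (coordField φ₀ 1 p)
      (coordField φ₀ 2 p) (D p V 1) (D p V 3) (sqNorm (Complex.I • E)) (2 * reInner p E)
      (D p (Complex.I • V) 1) (D p (Complex.I • V) 3)
    rw [← e1, ← e2, ← e3, ← e4, e6, ← cdet_apply] at e7
    have hpos := Complex.normSq_pos.2 hEV
    rw [e7] at hpos
    rw [e5]
    have hE' := reInner_eulerField_pos hα hp0
    exact mul_pos two_pos (pos_of_mul_pos_right hpos (by positivity))
  have hGc : ContinuousAt G p := continuousAt_det4 continuousAt_id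
    (hφ₀.continuousAt_coordField hpφ₀ 0) (hφ₀.continuousAt_coordField hpφ₀ 1)
    (hφ₀.continuousAt_coordField hpφ₀ 2)
  obtain ⟨φ, hφ, hpφ, hφU, hφΦ⟩ := exists_isSmoothChart hΦ (hD p) hinj
    (U := φ₀.source ∩ {q | 0 < G q})
    (inter_mem (φ₀.open_source.mem_nhds hpφ₀) (hGc.eventually_const_lt hGp))
  have hcoord : ∀ q ∈ φ.source, ∀ j, coordField φ j q = coordField φ₀ j q := by
    intro q hq j
    apply hφ₀.fderiv_injective (hφU hq).1
    rw [hφ₀.fderiv_coordField (hφU hq).1, hφ₀Φ, ← hφΦ, hφ.fderiv_coordField hq]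
  refine ⟨φ, ⟨hφ, fun q hq => ?_⟩, hpφ, ?_, ?_, _, hIE, ?_⟩
  · rw [hφΦ]
    change _ ∧ _ ∧ _ ↔ (polyFun f q).im = 0 ∧ sqNorm q - 1 = 0 ∧ -(polyFun f q).re ≤ 0
    rw [mem_S3_iff, sub_eq_zero, neg_nonpos]
    tauto
  · rw [hφΦ]
    change -(polyFun f p).re = 0
    rw [hp.2, Complex.zero_re, neg_zero]
  · rintro q ⟨hq, hqp⟩
    obtain ⟨a, ha⟩ := hXq q ⟨(hφU hq).1, hqp⟩
    rw [hcoord q hq, hcoord q hq, ha, det4_smul_add_smul]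
    exact mul_pos (mul_pos (by exact_mod_cast hd) hqp.2.2) (hφU hq).2
  · rw [hcoord p hpφ, hX]

/-- If `f` has no degenerate zeros outside the origin, then the nonnegative locus is a positive
section. -/
lemma isPositiveSection_nonnegLocus (hα : ∀ i, 0 < α i) (hd : 0 < d)
    (hf : IsWeightedHomogeneous α f d)
    (hdf : ∀ z : C2, z ≠ 0 → polyFun f z = 0 → polyDeriv f z ≠ 0) :
    IsPositiveSection α d (nonnegLocus f) := by
  have hchart := fun p (hp : p ∈ zeroLocus f) =>
    exists_positive_boundaryChart hα hd hf hp (hdf p (ne_zero_of_mem_S3 hp.1) hp.2)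
  have hb' : zeroLocus f ⊆ surfaceBoundary (nonnegLocus f) := by
    intro p hp
    obtain ⟨φ, hφ, hpφ, hp0, -⟩ := hchart p hp
    exact ⟨zeroLocus_subset_nonnegLocus f hp, φ, hφ, hpφ, hp0⟩
  have hi' := posLocus_subset_surfaceInterior hα hd hf
  have hb : surfaceBoundary (nonnegLocus f) = zeroLocus f := by
    refine subset_antisymm (fun p hp => ?_) hb'
    exact (mem_zeroLocus_or_mem_posLocus hp.1).resolve_right fun h =>
      notMem_surfaceInterior_of_mem_surfaceBoundary hp (hi' h)
  have hi : surfaceInterior (nonnegLocus f) = posLocus f := by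
    refine subset_antisymm (fun p hp => ?_) hi'
    exact (mem_zeroLocus_or_mem_posLocus hp.1).resolve_left fun h =>
      notMem_surfaceInterior_of_mem_surfaceBoundary (hb' h) hp
  have hne : ∀ p ∈ S3, p ∉ zeroLocus f → polyFun f p ≠ 0 := fun p hp h h0 => h ⟨hp, h0⟩
  refine ⟨⟨⟨fun p hp => hp.1, isCompact_nonnegLocus f, fun p hp => ?_⟩, ?_, ?_, ?_, ?_⟩, ?_⟩
  · rw [hb, hi]
    exact (mem_zeroLocus_or_mem_posLocus hp).symm
  · rw [hb]
    rintro p hp _ ⟨θ, rfl⟩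
    refine ⟨flow_mem_S3_iff.2 hp.1, ?_⟩
    simp only [polyFun_flow hf, hp.2, mul_zero]
  · rw [hi]
    exact fun p hp => flowField_notMem_tangentVectors hd hf hp
  · rw [hb, hi]
    exact fun p hp h => (orbit_inter_posLocus hd hf hp (hne p hp h)).1
  · rw [hb, hi]
    exact fun p hp h => (orbit_inter_posLocus hd hf hp (hne p hp h)).2
  · rw [hb]
    intro p hp
    obtain ⟨φ, hφ, hpφ, hp0, hpos, hc⟩ := hchart p hp
    refine ⟨φ, hφ, hpφ, hp0, ?_, hc⟩
    rw [IsPositiveChart, hi]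
    exact hpos

/-! ### Degenerate zeros of `f` -/

/-- A holomorphic function with a degenerate zero is a power with exponent at least `2` in a
suitable holomorphic coordinate, whose inverse is `ψ`. -/
lemma exists_comp_eventuallyEq_pow {h : ℂ → ℂ} (hh : AnalyticAt ℂ h 0) (h0 : h 0 = 0)
    (hderiv : HasDerivAt h 0 0) (hne : ¬ ∀ᶠ z in 𝓝 0, h z = 0) :
    ∃ k : ℕ, 2 ≤ k ∧ ∃ (ψ : ℂ → ℂ) (c : ℂ), c ≠ 0 ∧ ψ 0 = 0 ∧ HasDerivAt ψ c 0 ∧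
      ∀ᶠ t in 𝓝 0, h (ψ t) = t ^ k := by
  obtain ⟨k, g, hg, hg0, hhg⟩ := hh.exists_eventuallyEq_pow_smul_nonzero_iff.2 hne
  simp only [sub_zero, smul_eq_mul] at hhg
  have hk : 2 ≤ k := by
    by_contra hk
    have : k = 0 ∨ k = 1 := by omega
    rcases this with rfl | rfl
    · have := hhg.self_of_nhds
      rw [h0] at this
      exact hg0 (by simpa using this.symm)
    · have h1 : HasDerivAt (fun z => z ^ 1 * g z) (g 0) 0 := by
        simpa using ((hasDerivAt_id' (0 : ℂ)).fun_mul hg.differentiableAt.hasDerivAt)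
      exact hg0 ((h1.congr_of_eventuallyEq hhg).unique hderiv)
  have hk0 : k ≠ 0 := by omega
  obtain ⟨b, hb⟩ := IsAlgClosed.exists_pow_nat_eq (g 0) (Nat.pos_of_ne_zero hk0)
  have hb0 : b ≠ 0 := by
    rintro rfl
    exact hg0 (by rw [← hb, zero_pow hk0])
  -- A `k`-th root of `h`.
  let m : ℂ → ℂ := fun z => b * (g z / g 0) ^ ((k : ℂ)⁻¹)
  have hm0 : m 0 = b := by simp [m, div_self hg0]
  have hm : AnalyticAt ℂ m 0 := by
    refine analyticAt_const.mul ((hg.div analyticAt_const hg0).cpow analyticAt_const ?_)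
    simp [div_self hg0]
  have hr : HasStrictDerivAt (fun z => z * m z) b 0 := by
    have := (hasStrictDerivAt_id (0 : ℂ)).fun_mul hm.hasStrictDerivAt
    simpa [hm0] using this
  have hpow : ∀ᶠ z in 𝓝 0, h z = (z * m z) ^ k := by
    filter_upwards [hhg] with z hz
    rw [hz, mul_pow, mul_pow, Complex.cpow_nat_inv_pow _ hk0, hb, mul_div_cancel₀ _ hg0]
  have e0 : 0 * m 0 = 0 := zero_mul _
  have hψ := hr.to_localInverse hb0
  have hψ0 : hr.localInverse _ _ _ hb0 0 = 0 := by
    have := (hr.hasStrictFDerivAt_equiv hb0).localInverse_apply_image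
    rwa [e0] at this
  rw [e0] at hψ
  refine ⟨k, hk, hr.localInverse _ _ _ hb0, b⁻¹, inv_ne_zero hb0, hψ0, hψ.hasDerivAt, ?_⟩
  have hright := hr.eventually_right_inverse hb0
  rw [e0] at hright
  have hcont : Tendsto (hr.localInverse _ _ _ hb0) (𝓝 0) (𝓝 0) := by
    simpa [hψ0] using hψ.hasDerivAt.continuousAt.tendsto
  filter_upwards [hright, hcont.eventually hpow] with t h1 h2
  rw [h2, h1]

/-- There are lines through `p` that are transverse to the complex orbit of `p` and on which `f`
does not vanish identically. -/
lemma exists_transverse_direction (hf0 : f ≠ 0) (p : C2) {u : C2} (hu : u ≠ 0) :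
    ∃ w, cdet u w ≠ 0 ∧ polyFun f (p + w) ≠ 0 := by
  let g : MvPolynomial (Fin 2) ℂ := C (u 0) * (X 1 - C (p 1)) - C (u 1) * (X 0 - C (p 0))
  have hg : ∀ z, polyFun g z = cdet u (z - p) := by
    intro z
    simp [g, polyFun, cdet_apply]
  have hg0 : g ≠ 0 := by
    intro h
    have h1 : ∀ v, cdet u v = 0 := by
      intro v
      have := hg (p + v)
      rw [h, add_sub_cancel_left] at this
      rw [← this]
      simp [polyFun]
    apply hu
    ext i
    fin_cases i
    · simpa [cdet_apply] using h1 (EuclideanSpace.single 1 1)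
    · simpa [cdet_apply] using h1 (EuclideanSpace.single 0 1)
  obtain ⟨z, hz⟩ := exists_polyFun_ne_zero (mul_ne_zero hg0 hf0)
  rw [polyFun_mul, hg] at hz
  exact ⟨z - p, left_ne_zero_of_mul hz, by simpa using right_ne_zero_of_mul hz⟩

/-- A degenerate zero of `f` is not a boundary point of the nonnegative locus. Transversally to the
orbit, `f` is a `k`-th power with `k ≥ 2`, so that the surface has `k` sheets, with directions that
are permuted by the `k`-th roots of unity and add up to `0`. They cannot all point to the inner
side of a half plane. -/
lemma notMem_surfaceBoundary_of_polyDeriv_eq_zero (hα : ∀ i, 0 < α i)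
    (hf : IsWeightedHomogeneous α f d) (hf0 : f ≠ 0) (hp : p ∈ zeroLocus f)
    (hdf : polyDeriv f p = 0) (hflow : flowField α p ∈ tangentVectors (nonnegLocus f) p) :
    p ∉ surfaceBoundary (nonnegLocus f) := by
  rintro ⟨hpS, φ, hφ, hpφ, hφ0⟩
  have hp0 := ne_zero_of_mem_S3 hp.1
  set E := eulerField α p with hEdef
  have hE : E ≠ 0 := eulerField_ne_zero hα hp0
  have hEE : cdet E E = 0 := by rw [cdet_apply, mul_comm, sub_self]
  obtain ⟨w, hEw, hw⟩ := exists_transverse_direction hf0 p hE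
  -- The restriction of `f` to the complex line `p + ℂ w`.
  have han : AnalyticOnNhd ℂ (fun ζ : ℂ => polyFun f (p + ζ • w)) Set.univ := by
    intro ζ _
    have hl : AnalyticAt ℂ (fun ζ : ℂ => p + ζ • w) ζ :=
      analyticAt_const.add (analyticAt_id.smul analyticAt_const)
    exact (analyticOnNhd_polyFun f _ (Set.mem_univ _)).fun_comp hl
  have hline : HasDerivAt (fun ζ : ℂ => p + ζ • w) w 0 := by
    simpa using ((hasDerivAt_id (0 : ℂ)).smul_const w).const_add p
  have hderiv : HasDerivAt (fun ζ : ℂ => polyFun f (p + ζ • w)) 0 0 := by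
    have h1 : HasFDerivAt (polyFun f) (polyDeriv f p) (p + (0 : ℂ) • w) := by
      simpa using hasFDerivAt_polyFun f p
    simpa [hdf, Function.comp_def] using h1.comp_hasDerivAt (0 : ℂ) hline
  have hnz : ¬ ∀ᶠ ζ in 𝓝 (0 : ℂ), polyFun f (p + ζ • w) = 0 := by
    intro h
    have := han.eqOn_zero_of_preconnected_of_eventuallyEq_zero isPreconnected_univ
      (Set.mem_univ 0) h (Set.mem_univ 1)
    exact hw (by simpa using this)
  obtain ⟨k, hk, ψ, c, hc, hψ0, hψ, hψk⟩ := exists_comp_eventuallyEq_pow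
    (han 0 (Set.mem_univ 0)) (by simpa using hp.2) hderiv hnz
  obtain ⟨s, L, hs, hs0, hsev⟩ := exists_radial_projection hα hp.1
  -- The derivative at `p` of the radial projection, restricted to the line.
  let T : ℂ →+ C2 := AddMonoidHom.mk' (fun a => a • w + ((L (a • w) : ℝ) : ℂ) • E) <| by
    intro a b
    simp only [add_smul, map_add, Complex.ofReal_add]
    abel
  have hcurve : ∀ ξ : ℂ, ξ ^ k = 1 → fderiv ℝ φ p (T (c * ξ)) 0 ≤ 0 ∧
      fderiv ℝ φ p (T (c * ξ)) 2 = 0 ∧ fderiv ℝ φ p (T (c * ξ)) 3 = 0 := by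
    intro ξ hξ
    have hξt : HasDerivAt (fun t : ℝ => ξ * (t : ℂ)) ξ 0 := by
      simpa using (Complex.ofRealCLM.hasDerivAt (x := 0)).const_mul ξ
    have hβ : HasDerivAt (fun t : ℝ => p + ψ (ξ * t) • w) ((c * ξ) • w) 0 := by
      have h1 : HasDerivAt ψ c (ξ * ((0 : ℝ) : ℂ)) := by simpa using hψ
      have h2 : HasDerivAt (fun t : ℝ => ψ (ξ * t)) (c * ξ) 0 := by
        exact h1.comp (0 : ℝ) hξt
      exact (h2.smul_const w).const_add p
    have hβ0 : p + ψ (ξ * ((0 : ℝ) : ℂ)) • w = p := by simp [hψ0]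
    have hsβ : HasDerivAt (fun t : ℝ => ((s (p + ψ (ξ * t) • w) : ℝ) : ℂ))
        ((L ((c * ξ) • w) : ℝ) : ℂ) 0 := by
      have h1 : HasFDerivAt s L (p + ψ (ξ * ((0 : ℝ) : ℂ)) • w) := by rwa [hβ0]
      exact (h1.comp_hasDerivAt (0 : ℝ) hβ).ofReal_comp
    have hγ := hasDerivAt_act (α := α) hsβ hβ
    simp only [Complex.ofReal_zero, mul_zero, hψ0, zero_smul, add_zero, hs0, act_zero] at hγ
    refine hφ.fderiv_of_eventually hpS hpφ hφ0 ?_ hγ ?_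
    · simp [hψ0, hs0, act_zero]
    · have hβc : Tendsto (fun t : ℝ => p + ψ (ξ * t) • w) (𝓝 0) (𝓝 p) := by
        simpa [hψ0] using hβ.continuousAt.tendsto
      have hξc : Tendsto (fun t : ℝ => ξ * (t : ℂ)) (𝓝 0) (𝓝 0) := by
        simpa using hξt.continuousAt.tendsto
      filter_upwards [(hβc.eventually hsev).filter_mono nhdsWithin_le_nhds,
        (hξc.eventually hψk).filter_mono nhdsWithin_le_nhds, self_mem_nhdsWithin] with t h1 h2 h3
      refine ⟨h1, ?_⟩
      rw [polyFun_act_ofReal hf, h2, mul_pow, hξ, one_mul, ← Complex.ofReal_pow,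
        ← Complex.ofReal_mul]
      have ht : 0 < t := h3
      exact ⟨Complex.ofReal_im _, by rw [Complex.ofReal_re]; positivity⟩
  -- The sum over the roots of unity vanishes, and so do all the nonpositive summands.
  have hroot := Complex.isPrimitiveRoot_exp k (by omega)
  set ξ := Complex.exp (2 * Real.pi * Complex.I / k)
  have hξ : ∀ j, (ξ ^ j) ^ k = 1 := fun j => by
    rw [← pow_mul, mul_comm, pow_mul, hroot.pow_eq_one, one_pow]
  have hsum : ∑ j ∈ Finset.range k, fderiv ℝ φ p (T (c * ξ ^ j)) 0 = 0 := by
    rw [← Finset.sum_apply, ← map_sum, ← map_sum, ← Finset.mul_sum,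
      hroot.geom_sum_eq_zero (by omega), mul_zero, map_zero, map_zero, Pi.zero_apply]
  have hzero := (Finset.sum_eq_zero_iff_of_nonpos fun j _ => (hcurve _ (hξ j)).1).1 hsum 0
    (Finset.mem_range.2 (by omega))
  have h1 := hcurve 1 (one_pow k)
  rw [mul_one] at h1
  rw [pow_zero, mul_one] at hzero
  have hT := hφ.fderiv_of_mem_tangentVectors hpS hpφ hφ0 hflow
  set a := fderiv ℝ φ p (flowField α p) 1
  have hcomb : a • T c = fderiv ℝ φ p (T c) 1 • flowField α p := by
    apply hφ.1.fderiv_injective hpφ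
    rw [map_smul, map_smul, hT]
    ext j
    fin_cases j <;> simp [hzero, h1.2.1, h1.2.2, mul_comm]
  have ha : a ≠ 0 := by
    intro ha
    rw [ha, Pi.single_zero] at hT
    have := hφ.1.fderiv_injective hpφ (hT.trans (map_zero _).symm)
    rw [flowField_eq] at this
    exact smul_ne_zero Complex.I_ne_zero hE this
  have hdet := congrArg ((cdet E).restrictScalars ℝ) hcomb
  rw [map_smul, map_smul, flowField_eq] at hdet
  have e1 : (cdet E).restrictScalars ℝ (T c) = c * cdet E w := by
    change cdet E (c • w + ((L (c • w) : ℝ) : ℂ) • E) = _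
    rw [map_add, map_smul, map_smul, hEE]
    simp
  have e2 : (cdet E).restrictScalars ℝ (Complex.I • eulerField α p) = 0 := by
    change cdet E (Complex.I • E) = 0
    rw [map_smul, hEE, smul_zero]
  rw [e1, e2, smul_zero] at hdet
  exact smul_ne_zero ha (mul_ne_zero hc hEw) hdet

/-- If the nonnegative locus is a section, then `f` has no degenerate zeros outside the origin. -/
lemma polyDeriv_ne_zero_of_isSection (hα : ∀ i, 0 < α i) (hf : IsWeightedHomogeneous α f d)
    (hf0 : f ≠ 0) (hS : IsSection α d (nonnegLocus f)) {z : C2} (hz : z ≠ 0)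
    (hfz : polyFun f z = 0) : polyDeriv f z ≠ 0 := by
  intro hdz
  obtain ⟨s, hs⟩ := exists_act_mem_S3 hα hz
  set p := act α (s : ℂ) z with hpdef
  have hp : p ∈ zeroLocus f := ⟨hs, by rw [hpdef, polyFun_act hf, hfz, mul_zero]⟩
  have hdp : polyDeriv f p = 0 := by
    ext v
    have h1 : v = act α (s : ℂ) (act α (-s : ℂ) v) := by
      rw [act_act, add_neg_cancel, act_zero]
    rw [h1, hpdef, polyDeriv_act hf, hdz]
    simp
  have hflow : flowField α p ∈ tangentVectors (nonnegLocus f) p := by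
    refine ⟨fun t => flow α t p, flow_zero α p, hasDerivAt_flow α p,
      Eventually.of_forall fun t => ?_⟩
    refine zeroLocus_subset_nonnegLocus f ⟨flow_mem_S3_iff.2 hp.1, ?_⟩
    rw [polyFun_flow hf, hp.2, mul_zero]
  rcases hS.surface.2.2 p (zeroLocus_subset_nonnegLocus f hp) with h | h
  · exact hS.transverse p h hflow
  · exact notMem_surfaceBoundary_of_polyDeriv_eq_zero hα hf hf0 hp hdp hflow h

end SeifertSection

theorem mainTheorem6 (α : Fin 2 → ℕ) (hα : ∀ i, 0 < α i) (hcop : Nat.Coprime (α 0) (α 1))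
    (d : ℕ) (hd : 0 < d) (f : MvPolynomial (Fin 2) ℂ) (hf : f ≠ 0)
    (F : MvPolynomial (Fin 3) ℂ)
    (hF : F = MvPolynomial.rename Fin.succ f - MvPolynomial.X 0 ^ d)
    (hhom : MvPolynomial.IsWeightedHomogeneous (SeifertSection.weights α) F d) :
    SeifertSection.IsPositiveSection α d
        (closure (SeifertSection.radialImage α (SeifertSection.affinePart α F))) ↔
      SeifertSection.NonSingular F := by
  subst hF
  have hw := SeifertSection.isWeightedHomogeneous_of_rename hhom
  rw [SeifertSection.radialImage_eq_posLocus hd hw, SeifertSection.closure_posLocus hα hw hf,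
    SeifertSection.nonSingular_iff hα hd hw hf]
  exact ⟨fun h z hz hfz => SeifertSection.polyDeriv_ne_zero_of_isSection hα hw hf h.1 hz hfz,
    fun h => SeifertSection.isPositiveSection_nonnegLocus hα hd hw h⟩
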